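/- Let $k\ge 3$ and $m\ge 3$ be integers, and let $G$ be a linear $k$-uniform unicyclic hypergraph with (finite) vertex set $V$ and with exactly $m$ edges. Here $k$-uniform means that every edge has exactly $k$ vertices; linear means that any two distinct edges share at most one vertex; unicyclic means connected with exactly one cycle, where a cycle consists of $\ell\ge 2$ distinct vertices $v_1,\dots,v_\ell$ and $\ell$ distinct edges $e_1,\dots,e_\ell$ with $\{v_i,v_{i+1}\}\subseteq e_i$ (indices modulo $\ell$) and with $e_i\cap e_j=\emptyset$ whenever $e_i\neq e_j$ are not cyclically consecutive. Write $d_i$ for the degree of the vertex $i$ (the number of edges containing it). The ABC tensor of $G$ is the tensor $\mathcal T$ of order $k$, indexed by $V$, with entries $$\mathcal T_{i_1,\dots,i_k}=\frac{1}{(k-1)!}\left(\frac{\sum_{i\in e}d_i-k}{\prod_{i\in e}d_i}\right)^{1/k}\text{ if } e=\{i_1,\dots,i_k\}\text{ is an edge of }G,\qquad \mathcal T_{i_1,\dots,i_k}=0\text{ otherwise.}$$ A complex number $\lambda$ is an eigenvalue of $\mathcal T$ if there is a nonzero $x\in\mathbb C^V$ with $\sum_{i_2,\dots,i_k\in V}\mathcal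 T_{i,i_2,\dots,i_k}x_{i_2}\cdots x_{i_k}=\lambda x_i^{k-1}$ for all $i\in V$. The ABC spectral radius $\rho_{\mathcal{ABC}}(G)$ is the maximum modulus of an eigenvalue of $\mathcal T$ (this maximum exists). Let $U^{(k)}_{m,3}$ be the hypergraph obtained from the $k$-uniform hypercycle of length $3$ (vertices $v_1,\dots,v_{3(k-1)}$ and edges $e_i=\{v_{(i-1)(k-1)+1},\dots,v_{i(k-1)+1}\}$ for $i=1,2,3$, with $v_{3(k-1)+1}=v_1$) by adding $m-3$ pendant edges, each with $k-1$ new vertices, at one vertex of degree $2$. Let $a_m$ be the largest real root of $$t^3-\frac{\sqrt2}{2}t^2-\frac{m^2-4m+5}{m-1}\,t+\frac{\sqrt2\,(m^2-5m+6)}{2(m-1)}=0,$$ which exists. Then $$\rho_{\mathcal{ABC}}(G)\le a_m^{2/k},$$ with equality if and only if $G$ is isomorphic to $U^{(k)}_{m,3}$. -/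

import Mathlib

open scoped Classical in
/-- The vector `T x^{k-1}` of a real tensor `T` of order `k` (an array indexed by `k` indices in
`V`): its `i`-th coordinate is the sum of `T_{i₁ … i_k} x_{i₂} ⋯ x_{i_k}` over all index tuples
`(i₁, …, i_k)` with `i₁ = i`. The first position is the element of `Fin k` with value `0`. -/
noncomputable def tensorApply {V : Type*} [Fintype V] {k : ℕ} (T : (Fin k → V) → ℝ)
    (x : V → ℂ) (i : V) : ℂ :=
  ∑ f : Fin k → V with ∀ j : Fin k, (j : ℕ) = 0 → f j = i,
    (T f : ℂ) * ∏ j : Fin k with j.val ≠ 0, x (f j)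

/-- `z` is an eigenvalue of the tensor `T` of order `k`: the system `T x^{k-1} = z x^{[k-1]}` has
a nonzero complex solution. -/
def IsTensorEigenvalue {V : Type*} [Fintype V] {k : ℕ} (T : (Fin k → V) → ℝ) (z : ℂ) : Prop :=
  ∃ x : V → ℂ, x ≠ 0 ∧ ∀ i, tensorApply T x i = z * x i ^ (k - 1)

/-- The moduli of the eigenvalues of a tensor. -/
def tensorEigenvalueModuli {V : Type*} [Fintype V] {k : ℕ} (T : (Fin k → V) → ℝ) : Set ℝ :=
  {r | ∃ z : ℂ, IsTensorEigenvalue T z ∧ r = ‖z‖}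

/-- The spectral radius of a tensor: the largest modulus of an eigenvalue. -/
noncomputable def tensorSpectralRadius {V : Type*} [Fintype V] {k : ℕ}
    (T : (Fin k → V) → ℝ) : ℝ :=
  sSup (tensorEigenvalueModuli T)

namespace Hypergraph

/-- Every edge has exactly `k` vertices. -/
def IsUniform {V : Type*} (G : Hypergraph V) (k : ℕ) : Prop :=
  ∀ e ∈ G.edgeSet, e.ncard = k

/-- Any two distinct edges share at most one vertex. -/
def IsLinear {V : Type*} (G : Hypergraph V) : Prop :=
  ∀ e ∈ G.edgeSet, ∀ f ∈ G.edgeSet, e ≠ f → (e ∩ f).Subsingleton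

/-- There is a path from `u` to `w`: distinct vertices `v₀ = u, …, v_ℓ = w` and distinct edges
`e₀, …, e_{ℓ-1}` with `v_i, v_{i+1} ∈ e_i`, where non-consecutive edges are disjoint. -/
def HasPath {V : Type*} (G : Hypergraph V) (u w : V) : Prop :=
  ∃ (l : ℕ) (v : Fin (l + 1) → V) (e : Fin l → Set V),
    Function.Injective v ∧ Function.Injective e ∧
    (∀ i, e i ∈ G.edgeSet ∧ v i.castSucc ∈ e i ∧ v i.succ ∈ e i) ∧
    (∀ i j : Fin l, (i : ℕ) + 1 < j → Disjoint (e i) (e j)) ∧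
    v 0 = u ∧ v (Fin.last l) = w

/-- Any two vertices are joined by a path. -/
def IsConnected {V : Type*} (G : Hypergraph V) : Prop :=
  ∀ u ∈ G.vertexSet, ∀ w ∈ G.vertexSet, G.HasPath u w

/-- The vertex set `S` and the edge set `F` form a cycle of `G`: for some `ℓ ≥ 2`, `S` consists of
distinct vertices `v_i` and `F` of distinct edges `e_i` of `G` (`i` modulo `ℓ`) with
`v_i, v_{i+1} ∈ e_i`, and two edges that are not cyclically consecutive are disjoint. The map
`finRotate ℓ` sends `i` to `i + 1` modulo `ℓ`. -/
def IsCycle {V : Type*} (G : Hypergraph V) (S : Set V) (F : Set (Set V)) : Prop :=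
  ∃ (l : ℕ) (v : Fin l → V) (e : Fin l → Set V),
    2 ≤ l ∧ Function.Injective v ∧ Function.Injective e ∧
    (∀ i, e i ∈ G.edgeSet ∧ v i ∈ e i ∧ v (finRotate l i) ∈ e i) ∧
    (∀ i j, i ≠ j → j ≠ finRotate l i → i ≠ finRotate l j → Disjoint (e i) (e j)) ∧
    S = Set.range v ∧ F = Set.range e

/-- A unicyclic hypergraph: connected, with exactly one cycle. -/
def IsUnicyclic {V : Type*} (G : Hypergraph V) : Prop :=
  G.IsConnected ∧ ∃! C : Set V × Set (Set V), G.IsCycle C.1 C.2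

/-- The degree of a vertex: the number of edges containing it. -/
noncomputable def degree {V : Type*} (G : Hypergraph V) (x : V) : ℕ :=
  {e | e ∈ G.edgeSet ∧ x ∈ e}.ncard

open scoped Classical in
/-- `(∑_{i ∈ e} d_i - k) / ∏_{i ∈ e} d_i`. -/
noncomputable def abcWeight {V : Type*} [Fintype V] (G : Hypergraph V) (k : ℕ) (e : Set V) : ℝ :=
  ((∑ i : V with i ∈ e, (G.degree i : ℝ)) - k) / ∏ i : V with i ∈ e, (G.degree i : ℝ)

open scoped Classical in
/-- The ABC tensor of a `k`-uniform hypergraph with vertex set `V`. -/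
noncomputable def abcTensor {V : Type*} [Fintype V] (G : Hypergraph V) (k : ℕ)
    (f : Fin k → V) : ℝ :=
  if Set.range f ∈ G.edgeSet then
    1 / ((k - 1).factorial : ℝ) * G.abcWeight k (Set.range f) ^ ((1 : ℝ) / k)
  else 0

/-- The ABC spectral radius of a `k`-uniform hypergraph with vertex set `V`. -/
noncomputable def abcSpectralRadius {V : Type*} [Fintype V] (G : Hypergraph V) (k : ℕ) : ℝ :=
  tensorSpectralRadius (G.abcTensor k)

/-- Isomorphism of hypergraphs whose vertex sets are the full types `V` and `W`. -/
def IsIsomorphic {V W : Type*} (G : Hypergraph V) (H : Hypergraph W) : Prop :=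
  ∃ φ : V ≃ W, G.image φ = H

/-- The `k`-uniform hypercycle of length `g`. Its vertices `v_1, …, v_{g(k-1)}` in cyclic order are
written as pairs `(i, j)` with `i < g` and `j < k - 1` (standing for `v_{i(k-1)+j+1}`); the `i`-th
edge consists of the `k - 1` vertices `(i, j)` and of the first vertex `(i + 1, 0)` of the next
block, where `i + 1` is taken modulo `g`. -/
def hypercycle (g k : ℕ) : Hypergraph (Fin g × Fin (k - 1)) where
  vertexSet := Set.univ
  edgeSet := Set.range fun i : Fin g =>
    {p | p.1 = i ∨ (p.1 = finRotate g i ∧ (p.2 : ℕ) = 0)}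
  subset_vertexSet_of_mem_edgeSet' := fun _ _ => Set.subset_univ _

/-- The hypergraph obtained from `G` by adding `p` pendant edges with `k` vertices at the vertex
`u`: the `j`-th one consists of `u` and of `k - 1` new vertices `(j, i)`. -/
def addPendantEdges {V : Type*} (G : Hypergraph V) (k p : ℕ) (u : V) (hu : u ∈ G.vertexSet) :
    Hypergraph (V ⊕ (Fin p × Fin (k - 1))) where
  vertexSet := Sum.inl '' G.vertexSet ∪ Set.range Sum.inr
  edgeSet := ((fun e => Sum.inl '' e) '' G.edgeSet) ∪
    Set.range fun j : Fin p => insert (Sum.inl u) (Set.range fun i => Sum.inr (j, i))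
  subset_vertexSet_of_mem_edgeSet' := by
    rintro e (⟨s, hs, rfl⟩ | ⟨j, rfl⟩)
    · exact Set.subset_union_of_subset_left
        (Set.image_mono (G.subset_vertexSet_of_mem_edgeSet' hs)) _
    · rintro x (rfl | ⟨i, rfl⟩)
      · exact Or.inl ⟨u, hu, rfl⟩
      · exact Or.inr ⟨(j, i), rfl⟩

/-- `U_{m,3}^{(k)}`: the hypergraph obtained from the `k`-uniform hypercycle of length `3` by adding
`m - 3` pendant edges at the vertex `(0, 0)`, which has degree `2` in the hypercycle. -/
def unicyclicU3 (k m : ℕ) (hk : 3 ≤ k) :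
    Hypergraph ((Fin 3 × Fin (k - 1)) ⊕ (Fin (m - 3) × Fin (k - 1))) :=
  (hypercycle 3 k).addPendantEdges k (m - 3) (0, ⟨0, by omega⟩) trivial

end Hypergraph

/-! Write `w_e` for `abcWeight`. The `(k-1)!` orderings of the other vertices of an edge cancel the
factorial in the tensor, so `tensorApply_abcTensor` turns the eigenvalue equation at `i` into a sum
over the edges through `i`. Compactness shows that the spectral radius is attained. It is then
controlled by labelings `B v e` of the incidences: if the labels at each vertex sum to at most `1`
and `w_e ≤ R ∏ B v e` on each edge, then AM-GM bounds every eigenvalue by `R^(1/k)`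
(`norm_eigenvalue_le_of_labeling`). A positive labeling with equalities, of the form `c e / X v`,
gives exactly `R^(1/k)`, with eigenvector `X^(1/k)` (`abcSpectralRadius_eq_of_labeling`).

Two cases are distinguished. Suppose first that some vertex `u` misses at most one edge. The cycle
must be a triangle with exactly one edge avoiding `u`, and all remaining edges are pendant at `u`
(`exists_isTriangleSun`); this is `U_{m,3}` (`IsTriangleSun.isIsomorphic`). Solving the labeling
equations explicitly leaves one condition, at `u`, which is the cubic with `R = a²`
(`IsTriangleSun.abcSpectralRadius_eq`).

Otherwise all degrees are at most `m - 2`. Deleting one incidence of the unique cycle leaves an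
acyclic incidence graph, whence `∑ (d_v - 1) ≤ m` (`IsUnicyclic.sum_degree_sub_one_le`). A labeling
that perturbs `1 / d_v` satisfies the edge condition by Bernoulli's inequality, and the vertex
condition becomes an averaged inequality on the excesses of the edges through a vertex
(`norm_eigenvalue_le_of_excess`). That inequality holds for `R = abcThreshold m`, and the cubic is
negative at `√R`, so `R < a²`. The bound is strict here, which settles the equality case. -/

namespace Hypergraph

/-! ### Edges, degrees and weights as finite sums -/

open scoped Classical in
/-- The vertices of an edge, as a finite set. -/
noncomputable def verts {V : Type*} [Fintype V] (e : Set V) : Finset V := {i | i ∈ e}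

open scoped Classical in
/-- The edges of a hypergraph on a finite type, as a finite set. -/
noncomputable def edges {V : Type*} [Fintype V] (G : Hypergraph V) : Finset (Set V) :=
  {e | e ∈ G.edgeSet}

open scoped Classical in
/-- The edges through a vertex, as a finite set. -/
noncomputable def edgesAt {V : Type*} [Fintype V] (G : Hypergraph V) (i : V) : Finset (Set V) :=
  {e | e ∈ G.edgeSet ∧ i ∈ e}

section Basic

variable {V : Type*} [Fintype V]

@[simp] theorem mem_verts {e : Set V} {i : V} : i ∈ verts e ↔ i ∈ e := by simp [verts]

@[simp] theorem mem_edges {G : Hypergraph V} {e : Set V} : e ∈ G.edges ↔ e ∈ G.edgeSet := by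
  simp [edges]

@[simp] theorem mem_edgesAt {G : Hypergraph V} {i : V} {e : Set V} :
    e ∈ G.edgesAt i ↔ e ∈ G.edgeSet ∧ i ∈ e := by
  simp [edgesAt]

theorem card_verts (e : Set V) : (verts e).card = e.ncard := by
  rw [← Set.ncard_coe_finset]
  congr 1
  ext i
  simp

theorem card_edges (G : Hypergraph V) : G.edges.card = G.edgeSet.ncard := by
  rw [← Set.ncard_coe_finset]
  congr 1
  ext i
  simp

theorem degree_eq_card_edgesAt (G : Hypergraph V) (i : V) : G.degree i = (G.edgesAt i).card := by
  rw [← Set.ncard_coe_finset, degree]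
  congr 1
  ext e
  simp

theorem sum_sum_verts_comm {M : Type*} [AddCommMonoid M] (G : Hypergraph V) (F : V → Set V → M) :
    ∑ e ∈ G.edges, ∑ i ∈ verts e, F i e = ∑ i, ∑ e ∈ G.edgesAt i, F i e :=
  Finset.sum_comm' fun e i => by simp

theorem abcWeight_eq (G : Hypergraph V) (k : ℕ) {e : Set V} (he : e.ncard = k) :
    G.abcWeight k e =
      (∑ i ∈ verts e, ((G.degree i : ℝ) - 1)) / ∏ i ∈ verts e, (G.degree i : ℝ) := by
  rw [abcWeight, Finset.sum_sub_distrib, Finset.sum_const, card_verts, he]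
  simp [verts]

theorem one_le_degree_of_mem {G : Hypergraph V} {e : Set V} (he : e ∈ G.edgeSet) {i : V}
    (hi : i ∈ e) : 1 ≤ G.degree i := by
  rw [degree_eq_card_edgesAt, Nat.succ_le_iff, Finset.card_pos]
  exact ⟨e, by simp [he, hi]⟩

theorem abcWeight_nonneg (G : Hypergraph V) {k : ℕ} {e : Set V} (hG : e ∈ G.edgeSet)
    (he : e.ncard = k) : 0 ≤ G.abcWeight k e := by
  rw [abcWeight_eq G k he]
  refine div_nonneg (Finset.sum_nonneg fun i hi => ?_) (Finset.prod_nonneg fun i _ => by positivity)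
  have h := one_le_degree_of_mem hG (mem_verts.1 hi)
  have : (1 : ℝ) ≤ G.degree i := by exact_mod_cast h
  linarith

end Basic

/-! ### The ABC tensor as a sum over edges -/

theorem injective_of_ncard_range {V : Type*} {k : ℕ} {f : Fin k → V}
    (h : (Set.range f).ncard = k) : Function.Injective f := by
  classical
  have h2 : (Finset.univ.image f).card = (Finset.univ : Finset (Fin k)).card := by
    conv_rhs => rw [Finset.card_univ, Fintype.card_fin]
    rw [← Set.ncard_coe_finset]
    simpa using h
  simpa using Finset.card_image_iff.1 h2

-- A tuple with range `e` is injective, so fixing its first entry leaves a bijection from the other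
-- positions onto `e \ {i}`. This count cancels the factor `1 / (k-1)!` of the tensor.
open scoped Classical in
theorem card_filter_range_eq {V : Type*} [Fintype V] {n : ℕ} {e : Set V} {i : V} (hi : i ∈ e)
    (he : e.ncard = n + 1) :
    (Finset.univ.filter fun f : Fin (n + 1) → V => f 0 = i ∧ Set.range f = e).card
      = n.factorial := by
  have hcard : ((verts e).erase i).card = n := by
    rw [Finset.card_erase_of_mem (by simpa using hi), card_verts, he]; rfl
  have h1 : Fintype.card (Fin n ≃ ↥((verts e).erase i)) = n.factorial := by
    rw [Fintype.card_equiv (Finset.equivFinOfCardEq hcard).symm, Fintype.card_fin]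
  rw [← h1, ← Finset.card_univ]
  symm
  refine Finset.card_bij (fun σ _ => Fin.cons i fun j => (σ j : V)) ?_ ?_ ?_
  · intro σ _
    simp only [Finset.mem_filter, Finset.mem_univ, true_and, Fin.cons_zero]
    rw [Fin.range_cons]
    ext v
    simp only [Set.mem_insert_iff, Set.mem_range]
    constructor
    · rintro (rfl | ⟨j, rfl⟩)
      · exact hi
      · have := (σ j).2
        simp only [Finset.mem_erase, mem_verts] at this
        exact this.2
    · intro hv
      by_cases hvi : v = i
      · exact Or.inl hvi
      · exact Or.inr ⟨σ.symm ⟨v, by simp [hvi, hv]⟩, by simp⟩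
  · intro σ _ τ _ h
    ext j
    have := congrFun h j.succ
    simpa using this
  · intro f hf
    simp only [Finset.mem_filter, Finset.mem_univ, true_and] at hf
    obtain ⟨h0, hr⟩ := hf
    have hinj : Function.Injective f := injective_of_ncard_range (by rw [hr, he])
    have hmem : ∀ j : Fin n, f j.succ ∈ (verts e).erase i := fun j => by
      simp only [Finset.mem_erase, mem_verts]
      refine ⟨fun h => ?_, hr ▸ ⟨_, rfl⟩⟩
      rw [← h0] at h
      exact Fin.succ_ne_zero j (hinj h)
    refine ⟨Equiv.ofBijective (fun j => ⟨f j.succ, hmem j⟩) ?_, Finset.mem_univ _, ?_⟩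
    · rw [Fintype.bijective_iff_injective_and_card]
      refine ⟨fun a b hab => ?_, by rw [Fintype.card_coe, hcard, Fintype.card_fin]⟩
      simp only [Subtype.mk.injEq] at hab
      exact Fin.succ_injective _ (hinj hab)
    · funext j
      refine Fin.cases ?_ (fun j => ?_) j
      · simp [h0]
      · simp

open scoped Classical in
theorem prod_ne_zero_eq {V : Type*} [Fintype V] {n : ℕ} {e : Set V}
    (he : e.ncard = n + 1) {f : Fin (n + 1) → V} (hr : Set.range f = e) (x : V → ℂ) :
    ∏ j : Fin (n + 1) with j.val ≠ 0, x (f j) = ∏ v ∈ (verts e).erase (f 0), x v := by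
  have hinj : Function.Injective f := injective_of_ncard_range (by rw [hr, he])
  refine Finset.prod_bij (fun j _ => f j) ?_ ?_ ?_ ?_
  · intro j hj
    simp only [Finset.mem_filter, Finset.mem_univ, true_and] at hj
    simp only [Finset.mem_erase, mem_verts]
    exact ⟨fun h => hj (by rw [hinj h]; rfl), hr ▸ ⟨_, rfl⟩⟩
  · intro a _ b _ h
    exact hinj h
  · intro v hv
    simp only [Finset.mem_erase, mem_verts, ← hr, Set.mem_range] at hv
    obtain ⟨hv, j, rfl⟩ := hv
    refine ⟨j, ?_, rfl⟩
    simp only [Finset.mem_filter, Finset.mem_univ, true_and]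
    intro h
    exact hv (congrArg f (Fin.ext h))
  · intros; rfl

-- Group the index tuples by their range: the tensor vanishes unless the range is an edge, and all
-- tuples with the same edge contribute the same term.
open scoped Classical in
theorem tensorApply_abcTensor {V : Type*} [Fintype V] {k : ℕ} (hk : k ≠ 0) {G : Hypergraph V}
    (hG : G.IsUniform k) (x : V → ℂ) (i : V) :
    tensorApply (G.abcTensor k) x i =
      ∑ e ∈ G.edgesAt i,
        ((G.abcWeight k e ^ ((1 : ℝ) / k) : ℝ) : ℂ) * ∏ v ∈ (verts e).erase i, x v := by
  obtain ⟨n, rfl⟩ := Nat.exists_eq_succ_of_ne_zero hk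
  have h0 : ∀ f : Fin (n + 1) → V, (∀ j : Fin (n + 1), (j : ℕ) = 0 → f j = i) ↔ f 0 = i :=
    fun f => ⟨fun h => h 0 rfl, fun h j hj => by rw [← h]; exact congrArg f (Fin.ext hj)⟩
  have key : ∀ e ∈ G.edgesAt i,
      ((G.abcWeight (n + 1) e ^ ((1 : ℝ) / (n + 1 : ℕ)) : ℝ) : ℂ) * ∏ v ∈ (verts e).erase i, x v =
      ∑ f : Fin (n + 1) → V with f 0 = i ∧ Set.range f = e,
        (G.abcTensor (n + 1) f : ℂ) * ∏ j : Fin (n + 1) with j.val ≠ 0, x (f j) := by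
    intro e he
    rw [mem_edgesAt] at he
    have hen := hG e he.1
    rw [Finset.sum_congr rfl (g := fun _ => (((1 / (n.factorial : ℝ)) *
      (G.abcWeight (n + 1) e ^ ((1 : ℝ) / (n + 1 : ℕ))) : ℝ) : ℂ) *
        ∏ v ∈ (verts e).erase i, x v), Finset.sum_const, card_filter_range_eq he.2 hen]
    · have : (n.factorial : ℂ) ≠ 0 := by exact_mod_cast n.factorial_ne_zero
      rw [nsmul_eq_mul]
      push_cast
      field_simp
    · intro f hf
      simp only [Finset.mem_filter, Finset.mem_univ, true_and] at hf
      rw [prod_ne_zero_eq hen hf.2, abcTensor, hf.1, hf.2, if_pos he.1]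
      rfl
  rw [Finset.sum_congr rfl key, tensorApply]
  simp only [h0]
  have hsub : ∀ e ∈ G.edgesAt i,
      (Finset.univ.filter fun f : Fin (n + 1) → V => f 0 = i ∧ Set.range f = e) =
      (Finset.univ.filter fun f : Fin (n + 1) → V => f 0 = i ∧ Set.range f ∈ G.edgeSet).filter
        fun f => Set.range f = e := by
    intro e he
    rw [mem_edgesAt] at he
    ext f
    simp only [Finset.mem_filter, Finset.mem_univ, true_and]
    constructor
    · rintro ⟨h, rfl⟩; exact ⟨⟨h, he.1⟩, rfl⟩
    · rintro ⟨⟨h, -⟩, rfl⟩; exact ⟨h, rfl⟩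
  symm
  rw [Finset.sum_congr rfl fun e he => by rw [hsub e he], Finset.sum_fiberwise_of_maps_to]
  · refine Finset.sum_subset (fun f hf => ?_) fun f hf hf' => ?_
    · simp only [Finset.mem_filter, Finset.mem_univ, true_and] at hf ⊢
      exact hf.1
    · simp only [Finset.mem_filter, Finset.mem_univ, true_and, not_and] at hf hf'
      rw [abcTensor, if_neg (hf' hf), Complex.ofReal_zero, zero_mul]
  · intro f hf
    simp only [Finset.mem_filter, Finset.mem_univ, true_and] at hf
    rw [mem_edgesAt]
    exact ⟨hf.2, hf.1 ▸ ⟨0, rfl⟩⟩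

end Hypergraph

/-! ### The spectral radius is attained -/

section Tensor

/-- Cross-multiplying eliminates the eigenvalue, so that being an eigenvector becomes a closed
condition on `x`. -/
theorem exists_eq_mul_iff {V : Type*} {n : ℕ} {x : V → ℂ} (hx : x ≠ 0) (y : V → ℂ) :
    (∃ z : ℂ, ∀ i, y i = z * x i ^ n) ↔ ∀ i j, y i * x j ^ n = y j * x i ^ n := by
  constructor
  · rintro ⟨z, hz⟩ i j
    rw [hz i, hz j]
    ring
  · intro h
    obtain ⟨j, hj⟩ := Function.ne_iff.1 hx
    have hj' : x j ^ n ≠ 0 := pow_ne_zero _ hj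
    refine ⟨y j / x j ^ n, fun i => ?_⟩
    rw [div_mul_eq_mul_div, eq_div_iff hj', h i j]

variable {V : Type*} [Fintype V] {k : ℕ}

open scoped Classical in
theorem card_filter_val_ne_zero (hk : k ≠ 0) :
    (Finset.univ.filter fun j : Fin k => j.val ≠ 0).card = k - 1 := by
  obtain ⟨n, rfl⟩ := Nat.exists_eq_succ_of_ne_zero hk
  have : (Finset.univ.filter fun j : Fin (n + 1) => j.val ≠ 0) = Finset.univ.erase 0 := by
    ext j
    simp only [Finset.mem_filter, Finset.mem_univ, true_and, Finset.mem_erase, and_true]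
    exact not_congr Fin.val_eq_zero_iff
  convert congrArg Finset.card this using 1
  simp

theorem tensorApply_smul (hk : k ≠ 0) (T : (Fin k → V) → ℝ) (c : ℂ) (x : V → ℂ) (i : V) :
    tensorApply T (c • x) i = c ^ (k - 1) * tensorApply T x i := by
  classical
  rw [tensorApply, tensorApply, Finset.mul_sum]
  refine Finset.sum_congr rfl fun f _ => ?_
  simp only [Pi.smul_apply, smul_eq_mul]
  rw [Finset.prod_mul_distrib, Finset.prod_const, card_filter_val_ne_zero hk]
  ring

theorem continuous_tensorApply (T : (Fin k → V) → ℝ) :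
    Continuous fun x : V → ℂ => tensorApply T x := by
  refine continuous_pi fun i => ?_
  unfold tensorApply
  fun_prop

theorem norm_pow_pi [Nonempty V] {n : ℕ} (x : V → ℂ) : ‖fun i => x i ^ n‖ = ‖x‖ ^ n := by
  obtain ⟨i, -, hi⟩ := Finset.exists_mem_eq_sup' Finset.univ_nonempty fun i => ‖x i‖
  have hmax : ∀ j, ‖x j‖ ≤ ‖x i‖ := fun j => hi ▸ Finset.le_sup' (fun i => ‖x i‖) (Finset.mem_univ j)
  have h1 : ‖x‖ = ‖x i‖ :=
    le_antisymm ((pi_norm_le_iff_of_nonneg (norm_nonneg _)).2 hmax) (norm_le_pi_norm x i)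
  rw [h1]
  refine le_antisymm ((pi_norm_le_iff_of_nonneg (by positivity)).2 fun j => ?_) ?_
  · rw [norm_pow]
    exact pow_le_pow_left₀ (norm_nonneg _) (hmax j) n
  · rw [← norm_pow]
    exact norm_le_pi_norm (fun i => x i ^ n) i

/-- The eigenvalue moduli are the norms of `T x^{k-1}` at the unit vectors `x` for which
`T x^{k-1}` is proportional to `x^{[k-1]}`. -/
theorem tensorEigenvalueModuli_eq_image [Nonempty V] (hk : k ≠ 0) (T : (Fin k → V) → ℝ) :
    tensorEigenvalueModuli T = (fun x : V → ℂ => ‖tensorApply T x‖) ''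
      (Metric.sphere 0 1 ∩ {x | ∀ i j, tensorApply T x i * x j ^ (k - 1) =
        tensorApply T x j * x i ^ (k - 1)}) := by
  ext r
  constructor
  · rintro ⟨z, ⟨x, hx, hz⟩, rfl⟩
    have hx' : (‖x‖ : ℂ) ≠ 0 := by simpa using hx
    set y : V → ℂ := (‖x‖ : ℂ)⁻¹ • x with hy
    have hy1 : ‖y‖ = 1 := by
      rw [hy, norm_smul, norm_inv, Complex.norm_real, norm_norm]
      exact inv_mul_cancel₀ (by simpa using hx)
    have hy0 : y ≠ 0 := by
      intro h
      rw [h, norm_zero] at hy1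
      exact zero_ne_one hy1
    have hyz : ∀ i, tensorApply T y i = z * y i ^ (k - 1) := fun i => by
      rw [hy, tensorApply_smul hk, hz]
      simp only [Pi.smul_apply, smul_eq_mul]
      ring
    refine ⟨y, ⟨by simpa using hy1, (exists_eq_mul_iff hy0 _).1 ⟨z, hyz⟩⟩, ?_⟩
    have : tensorApply T y = z • fun i => y i ^ (k - 1) := funext hyz
    simp only [this, norm_smul, norm_pow_pi, hy1, one_pow, mul_one]
  · rintro ⟨y, ⟨hy1, hy⟩, rfl⟩
    have hy1 : ‖y‖ = 1 := by simpa using hy1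
    have hy0 : y ≠ 0 := by
      intro h
      rw [h, norm_zero] at hy1
      exact zero_ne_one hy1
    obtain ⟨z, hz⟩ := (exists_eq_mul_iff hy0 _).2 hy
    refine ⟨z, ⟨y, hy0, hz⟩, ?_⟩
    have : tensorApply T y = z • fun i => y i ^ (k - 1) := funext hz
    simp only [this, norm_smul, norm_pow_pi, hy1, one_pow, mul_one]

/-- By homogeneity the moduli are the continuous image of a closed subset of the unit sphere, hence
a compact set. -/
theorem isGreatest_tensorSpectralRadius (hk : k ≠ 0) {T : (Fin k → V) → ℝ}
    (hT : (tensorEigenvalueModuli T).Nonempty) :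
    IsGreatest (tensorEigenvalueModuli T) (tensorSpectralRadius T) := by
  have : Nonempty V := by
    obtain ⟨r, z, ⟨x, hx, -⟩, -⟩ := hT
    obtain ⟨i, -⟩ := Function.ne_iff.1 hx
    exact ⟨i⟩
  refine IsCompact.isGreatest_sSup ?_ hT
  rw [tensorEigenvalueModuli_eq_image hk]
  refine IsCompact.image (IsCompact.inter_right (isCompact_sphere 0 1) ?_)
    (continuous_tensorApply T).norm
  simp only [Set.ofPred_forall]
  have hc := continuous_tensorApply T
  refine isClosed_iInter fun i => isClosed_iInter fun j => isClosed_eq ?_ ?_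
  · exact ((continuous_apply i).comp hc).mul ((continuous_apply j).pow _)
  · exact ((continuous_apply j).comp hc).mul ((continuous_apply i).pow _)

end Tensor

/-! ### Incidence labelings that bound or determine the spectral radius -/

namespace Hypergraph

variable {V : Type*} [Fintype V] {k : ℕ} {G : Hypergraph V}

/-- A coordinate vector is an eigenvector for `0`: for `k ≥ 3` each product runs over at least two
vertices, one of which is not `u`. -/
theorem abcTensor_moduli_nonempty [Nonempty V] (hk : 3 ≤ k) (hG : G.IsUniform k) :
    (tensorEigenvalueModuli (G.abcTensor k)).Nonempty := by
  classical
  obtain ⟨u⟩ := ‹Nonempty V›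
  refine ⟨_, 0, ⟨Pi.single u 1, ?_, fun i => ?_⟩, rfl⟩
  · simp
  · rw [tensorApply_abcTensor (by omega) hG, zero_mul]
    refine Finset.sum_eq_zero fun e he => ?_
    have h2 : 1 < ((verts e).erase i).card := by
      rw [mem_edgesAt] at he
      rw [Finset.card_erase_of_mem (by simpa using he.2), card_verts, hG e he.1]
      omega
    obtain ⟨a, ha, hau⟩ := Finset.exists_mem_ne h2 u
    rw [Finset.prod_eq_zero ha (by simp [hau]), mul_zero]

/-- The upper bound for eigenvalues given by a subnormal labeling of the incidences. -/
theorem norm_eigenvalue_le_of_labeling (hk : k ≠ 0) (hG : G.IsUniform k) {R : ℝ} (hR : 0 ≤ R)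
    (B : V → Set V → ℝ) (hB : ∀ e ∈ G.edgeSet, ∀ v ∈ e, 0 ≤ B v e)
    (hsum : ∀ v, ∑ e ∈ G.edgesAt v, B v e ≤ 1)
    (hprod : ∀ e ∈ G.edgeSet, G.abcWeight k e ≤ R * ∏ v ∈ verts e, B v e)
    {z : ℂ} (hz : IsTensorEigenvalue (G.abcTensor k) z) : ‖z‖ ≤ R ^ ((1 : ℝ) / k) := by
  classical
  have hk' : (0 : ℝ) < k := by exact_mod_cast Nat.pos_of_ne_zero hk
  obtain ⟨x, hx, hxz⟩ := hz
  have hpos : 0 < ∑ v, ‖x v‖ ^ k := by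
    obtain ⟨i, hi⟩ := Function.ne_iff.1 hx
    exact Finset.sum_pos' (fun _ _ => by positivity)
      ⟨i, Finset.mem_univ i, pow_pos (norm_pos_iff.2 hi) k⟩
  refine le_of_mul_le_mul_right ?_ hpos
  have hw : ∀ e ∈ G.edgeSet, 0 ≤ G.abcWeight k e ^ ((1 : ℝ) / k) := fun e he =>
    Real.rpow_nonneg (abcWeight_nonneg G he (hG e he)) _
  -- Multiplying row `v` by `‖x v‖` completes each edge product, which then no longer depends on
  -- `v`; the rows can be summed edge by edge.
  have hrow : ∀ v, ‖z‖ * ‖x v‖ ^ k ≤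
      ∑ e ∈ G.edgesAt v, G.abcWeight k e ^ ((1 : ℝ) / k) * ∏ u ∈ verts e, ‖x u‖ := by
    intro v
    have h1 : ‖z‖ * ‖x v‖ ^ k = ‖tensorApply (G.abcTensor k) x v‖ * ‖x v‖ := by
      rw [hxz, norm_mul, norm_pow, mul_assoc, ← pow_succ, Nat.sub_add_cancel (by omega)]
    rw [h1, tensorApply_abcTensor hk hG, ← norm_mul, Finset.sum_mul]
    refine (norm_sum_le _ _).trans (Finset.sum_le_sum fun e he => ?_)
    rw [mem_edgesAt] at he
    rw [mul_assoc, norm_mul, Complex.norm_real, Real.norm_of_nonneg (hw e he.1),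
      Finset.prod_erase_mul _ _ (by simpa using he.2), norm_prod]
  have hedge : ∀ e ∈ G.edges, ∑ v ∈ verts e,
        G.abcWeight k e ^ ((1 : ℝ) / k) * ∏ u ∈ verts e, ‖x u‖ ≤
      ∑ v ∈ verts e, R ^ ((1 : ℝ) / k) * (B v e * ‖x v‖ ^ k) := by
    intro e he
    rw [mem_edges] at he
    have hBe : ∀ v ∈ verts e, 0 ≤ B v e := fun v hv => hB e he v (by simpa using hv)
    have hcard : (verts e).card = k := by rw [card_verts, hG e he]
    have h1 : G.abcWeight k e ^ ((1 : ℝ) / k) ≤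
        R ^ ((1 : ℝ) / k) * ∏ v ∈ verts e, B v e ^ ((1 : ℝ) / k) := by
      rw [Real.finsetProd_rpow _ _ hBe, ← Real.mul_rpow hR (Finset.prod_nonneg hBe)]
      exact Real.rpow_le_rpow (abcWeight_nonneg G he (hG e he)) (hprod e he) (by positivity)
    -- AM-GM with equal weights `1 / k`, applied to the labeled powers rather than to `‖x v‖ ^ k`
    -- alone.
    have h2 : ∏ v ∈ verts e, (B v e * ‖x v‖ ^ k) ^ ((1 : ℝ) / k) ≤
        ∑ v ∈ verts e, (1 : ℝ) / k * (B v e * ‖x v‖ ^ k) := by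
      refine Real.geom_mean_le_arith_mean_weighted _ _ _ (fun _ _ => by positivity) ?_
        fun v hv => mul_nonneg (hBe v hv) (by positivity)
      rw [Finset.sum_const, hcard, nsmul_eq_mul]
      field_simp
    have h3 : ∏ v ∈ verts e, (B v e * ‖x v‖ ^ k) ^ ((1 : ℝ) / k) =
        (∏ v ∈ verts e, B v e ^ ((1 : ℝ) / k)) * ∏ u ∈ verts e, ‖x u‖ := by
      rw [← Finset.prod_mul_distrib]
      refine Finset.prod_congr rfl fun v hv => ?_
      rw [Real.mul_rpow (hBe v hv) (by positivity), one_div,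
        Real.pow_rpow_inv_natCast (norm_nonneg _) hk]
    rw [Finset.sum_const, hcard, nsmul_eq_mul, ← Finset.mul_sum]
    calc (k : ℝ) * (G.abcWeight k e ^ ((1 : ℝ) / k) * ∏ u ∈ verts e, ‖x u‖)
        ≤ k * ((R ^ ((1 : ℝ) / k) * ∏ v ∈ verts e, B v e ^ ((1 : ℝ) / k)) *
            ∏ u ∈ verts e, ‖x u‖) := by gcongr
      _ = k * R ^ ((1 : ℝ) / k) * ∏ v ∈ verts e, (B v e * ‖x v‖ ^ k) ^ ((1 : ℝ) / k) := by
          rw [h3]; ring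
      _ ≤ k * R ^ ((1 : ℝ) / k) * ∑ v ∈ verts e, (1 : ℝ) / k * (B v e * ‖x v‖ ^ k) := by gcongr
      _ = R ^ ((1 : ℝ) / k) * ∑ v ∈ verts e, B v e * ‖x v‖ ^ k := by
          rw [← Finset.mul_sum]; field_simp
  calc ‖z‖ * ∑ v, ‖x v‖ ^ k = ∑ v, ‖z‖ * ‖x v‖ ^ k := Finset.mul_sum _ _ _
    _ ≤ ∑ v, ∑ e ∈ G.edgesAt v, G.abcWeight k e ^ ((1 : ℝ) / k) * ∏ u ∈ verts e, ‖x u‖ :=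
        Finset.sum_le_sum fun v _ => hrow v
    _ = ∑ e ∈ G.edges, ∑ v ∈ verts e,
          G.abcWeight k e ^ ((1 : ℝ) / k) * ∏ u ∈ verts e, ‖x u‖ :=
        (sum_sum_verts_comm G _).symm
    _ ≤ ∑ e ∈ G.edges, ∑ v ∈ verts e, R ^ ((1 : ℝ) / k) * (B v e * ‖x v‖ ^ k) :=
        Finset.sum_le_sum hedge
    _ = ∑ v, ∑ e ∈ G.edgesAt v, R ^ ((1 : ℝ) / k) * (B v e * ‖x v‖ ^ k) :=
        sum_sum_verts_comm G _
    _ ≤ ∑ v, R ^ ((1 : ℝ) / k) * ‖x v‖ ^ k := by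
        refine Finset.sum_le_sum fun v _ => ?_
        rw [← Finset.mul_sum, ← Finset.sum_mul]
        gcongr
        exact mul_le_of_le_one_left (by positivity) (hsum v)
    _ = R ^ ((1 : ℝ) / k) * ∑ v, ‖x v‖ ^ k := (Finset.mul_sum _ _ _).symm

/-- A consistent normal labeling, written through the `k`-th powers `X` of the coordinates of an
eigenvector, determines the spectral radius. -/
theorem abcSpectralRadius_eq_of_labeling [Nonempty V] (hk : 3 ≤ k) (hG : G.IsUniform k) {R : ℝ}
    (hR : 0 ≤ R) (X : V → ℝ) (c : Set V → ℝ) (hX : ∀ v, 0 < X v)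
    (hc : ∀ e ∈ G.edgeSet, 0 < c e) (hsum : ∀ v, ∑ e ∈ G.edgesAt v, c e = X v)
    (hprod : ∀ e ∈ G.edgeSet, G.abcWeight k e * ∏ v ∈ verts e, X v = R * c e ^ k) :
    G.abcSpectralRadius k = R ^ ((1 : ℝ) / k) := by
  classical
  have hk0 : k ≠ 0 := by omega
  have hgr := isGreatest_tensorSpectralRadius hk0 (abcTensor_moduli_nonempty hk hG)
  have hRk : 0 ≤ R ^ ((1 : ℝ) / k) := Real.rpow_nonneg hR _
  refine le_antisymm ?_ (hgr.2 ⟨(R ^ ((1 : ℝ) / k) : ℝ), ⟨fun v => (X v ^ ((1 : ℝ) / k) : ℝ), ?_, ?_⟩,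
    by rw [Complex.norm_real, Real.norm_of_nonneg hRk]⟩)
  · obtain ⟨z, hz, hzr⟩ := hgr.1
    rw [abcSpectralRadius, hzr]
    refine norm_eigenvalue_le_of_labeling hk0 hG hR (fun v e => c e / X v)
      (fun e he v _ => (div_pos (hc e he) (hX v)).le) (fun v => ?_) (fun e he => ?_) hz
    · rw [← Finset.sum_div, hsum, div_self (hX v).ne']
    · rw [Finset.prod_div_distrib, Finset.prod_const, card_verts, hG e he, ← mul_div_assoc,
        ← hprod e he, mul_div_cancel_right₀ _ (Finset.prod_pos fun v _ => hX v).ne']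
  · obtain ⟨u⟩ := ‹Nonempty V›
    intro h
    have := congrFun h u
    simp only [Pi.zero_apply, Complex.ofReal_eq_zero] at this
    exact (Real.rpow_pos_of_pos (hX u) _).ne' this
  · intro i
    rw [tensorApply_abcTensor hk0 hG]
    have hxi : 0 < X i ^ ((1 : ℝ) / k) := Real.rpow_pos_of_pos (hX i) _
    have hXi : X i ^ ((1 : ℝ) / k) * (X i ^ ((1 : ℝ) / k)) ^ (k - 1) = X i := by
      rw [← pow_succ', Nat.sub_add_cancel (by omega), one_div,
        Real.rpow_inv_natCast_pow (hX i).le hk0]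
    have key : X i ^ ((1 : ℝ) / k) * ∑ e ∈ G.edgesAt i,
        G.abcWeight k e ^ ((1 : ℝ) / k) * ∏ v ∈ (verts e).erase i, X v ^ ((1 : ℝ) / k) =
        R ^ ((1 : ℝ) / k) * X i := by
      rw [← hsum i, Finset.mul_sum, Finset.mul_sum]
      refine Finset.sum_congr rfl fun e he => ?_
      rw [mem_edgesAt] at he
      rw [hsum i, mul_left_comm, Finset.mul_prod_erase _ (fun v => X v ^ ((1 : ℝ) / k))
        (by simpa using he.2), Real.finsetProd_rpow _ _ fun v _ => (hX v).le,
        ← Real.mul_rpow (abcWeight_nonneg G he.1 (hG e he.1))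
          (Finset.prod_nonneg fun v _ => (hX v).le), hprod e he.1,
        Real.mul_rpow hR (pow_nonneg (hc e he.1).le _), one_div,
        Real.pow_rpow_inv_natCast (hc e he.1).le hk0]
    have key2 : ∑ e ∈ G.edgesAt i,
        G.abcWeight k e ^ ((1 : ℝ) / k) * ∏ v ∈ (verts e).erase i, X v ^ ((1 : ℝ) / k) =
        R ^ ((1 : ℝ) / k) * (X i ^ ((1 : ℝ) / k)) ^ (k - 1) := by
      refine mul_left_cancel₀ hxi.ne' ?_
      rw [key, mul_left_comm, hXi]
    simpa only [Complex.ofReal_sum, Complex.ofReal_mul, Complex.ofReal_prod, Complex.ofReal_pow]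
      using congrArg Complex.ofReal key2

end Hypergraph

/-! ### Inequalities for averaged excesses -/

section Numeric

/-- A strict lower bound for the `k`-th power of the spectral radius of the extremal hypergraph. -/
noncomputable def abcThreshold (m : ℕ) : ℝ :=
  if m = 4 then 12 / 5 else (m : ℝ) - 3 + 3 / (2 * m - 7)

theorem abcThreshold_pos {m : ℕ} (hm : 4 ≤ m) : 0 < abcThreshold m := by
  rw [abcThreshold]
  split_ifs with h
  · norm_num
  · have : (5 : ℝ) ≤ m := by exact_mod_cast (by omega : 5 ≤ m)
    have : 0 < 3 / (2 * (m : ℝ) - 7) := div_pos (by norm_num) (by linarith)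
    linarith

/-- The left side is the line through the values `D` at `r = 0` and `(D - 1) / 2` at `r = 1`; for
larger `r` the extra room comes from `2 ≤ a ≤ r + 1`. Being linear in `r`, it can be summed knowing
only `∑ r`. -/
theorem slope_le_sub_div {D : ℝ} (hD : 0 ≤ D) {r a : ℕ} (h0 : r = 0 → a = 1)
    (h1 : r ≠ 0 → 2 ≤ a ∧ a ≤ r + 1) : D - (D + 1) / 2 * r ≤ (D - r) / a := by
  rcases eq_or_ne r 0 with rfl | hr
  · simp [h0 rfl]
  obtain ⟨h2, h3⟩ := h1 hr
  have h2' : (2 : ℝ) ≤ a := by exact_mod_cast h2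
  have h3' : (a : ℝ) ≤ r + 1 := by exact_mod_cast h3
  have hr' : (1 : ℝ) ≤ r := by exact_mod_cast Nat.one_le_iff_ne_zero.2 hr
  rw [le_div_iff₀ (by linarith)]
  have e1 : 0 ≤ (D + 1) * (r - 1) * (a - 2) :=
    mul_nonneg (mul_nonneg (by linarith) (by linarith)) (by linarith)
  have e2 : 0 ≤ (r + 1 - a : ℝ) * (1 + D) := mul_nonneg (by linarith) (by linarith)
  have e3 : 0 ≤ D * (r - 1 : ℝ) := mul_nonneg hD (by linarith)
  nlinarith

/-- For `r ≥ 2` the numerator is nonpositive, so a denominator larger than `2` only helps. This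
linear bound replaces the slope bound when `M = 4`. -/
theorem half_le_sub_div {D : ℝ} (hD : D ≤ 2) (hD0 : 0 ≤ D) {r a : ℕ} (h0 : r = 0 → a = 1)
    (h1 : r ≠ 0 → 2 ≤ a ∧ a ≤ r + 1) : (D - r) / 2 ≤ (D - r) / a := by
  rcases eq_or_ne r 0 with rfl | hr
  · simp only [h0 rfl, Nat.cast_zero, Nat.cast_one]
    linarith
  obtain ⟨h2, h3⟩ := h1 hr
  have h2' : (2 : ℝ) ≤ a := by exact_mod_cast h2
  rw [div_le_div_iff₀ two_pos (by linarith)]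
  rcases eq_or_ne r 1 with rfl | hr1
  · have : a = 2 := by omega
    rw [this]; simp
  · have : (2 : ℝ) ≤ r := by exact_mod_cast (by omega : 2 ≤ r)
    nlinarith

variable {ι : Type*} [DecidableEq ι] {s : Finset ι} {r a : ι → ℕ} {M δ : ℕ}

omit [DecidableEq ι] in
theorem slope_le_sum {D : ℝ} (hD : 0 ≤ D) (h0 : ∀ f ∈ s, r f = 0 → a f = 1)
    (h1 : ∀ f ∈ s, r f ≠ 0 → 2 ≤ a f ∧ a f ≤ r f + 1) :
    s.card * D - (D + 1) / 2 * (∑ f ∈ s, r f : ℕ) ≤ ∑ f ∈ s, (D - r f) / a f := by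
  have : s.card * D - (D + 1) / 2 * (∑ f ∈ s, r f : ℕ) = ∑ f ∈ s, (D - (D + 1) / 2 * r f) := by
    rw [Finset.sum_sub_distrib, Finset.sum_const, ← Finset.mul_sum, nsmul_eq_mul]
    push_cast
    rfl
  rw [this]
  exact Finset.sum_le_sum fun f hf => slope_le_sub_div hD (h0 f hf) (h1 f hf)

/-- A negative term needs `r > D > M - 3`, so it uses up all but at most `2` of the total `M`. One
heavy term is isolated and compensated by the others. -/
theorem sum_sub_div_nonneg_of_five_le (hM : 5 ≤ M) (hδ : 1 ≤ δ) (hcard : s.card = δ + 1)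
    (hr : ∑ f ∈ s, r f ≤ M) (h0 : ∀ f ∈ s, r f = 0 → a f = 1)
    (h1 : ∀ f ∈ s, r f ≠ 0 → 2 ≤ a f ∧ a f ≤ r f + 1) {ε D : ℝ}
    (hε : ε = 3 / (2 * (M + δ) - 7)) (hD : D = M - 3 + ε) :
    0 ≤ ∑ f ∈ s, (D - r f) / a f := by
  have hM' : (5 : ℝ) ≤ M := by exact_mod_cast hM
  have hδ' : (1 : ℝ) ≤ δ := by exact_mod_cast hδ
  have hε0 : 0 < ε := by rw [hε]; apply div_pos <;> linarith
  have hD2 : 2 < D := by linarith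
  have hlight : ∀ f ∈ s, (r f : ℝ) ≤ D → 0 ≤ (D - r f) / a f := fun f _ h =>
    div_nonneg (by linarith) (by positivity)
  by_cases hh : ∀ f ∈ s, (r f : ℝ) ≤ D
  · exact Finset.sum_nonneg fun f hf => hlight f hf (hh f hf)
  push Not at hh
  obtain ⟨h, hs, hlt⟩ := hh
  have hrh : M - 2 ≤ r h := by
    have : ((M : ℝ) - 3) < r h := by linarith
    have : (M : ℝ) < (r h + 3 : ℕ) := by push_cast; linarith
    have : M < r h + 3 := by exact_mod_cast this
    omega
  rw [← Finset.add_sum_erase s _ hs]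
  have hsum' : r h + ∑ f ∈ s.erase h, r f ≤ M := by rwa [Finset.add_sum_erase s r hs]
  set σ := ∑ f ∈ s.erase h, r f with hσ
  -- The numerator is negative, so the smallest possible denominator `2` is the worst case.
  have hgh : (D - M + σ) / 2 ≤ (D - r h) / a h := by
    have h2 : (2 : ℝ) ≤ a h := by exact_mod_cast (h1 h hs (by omega)).1
    have h3 : (r h : ℝ) + σ ≤ M := by exact_mod_cast hsum'
    rw [div_le_div_iff₀ two_pos (by linarith)]
    nlinarith
  have hcard' : (s.erase h).card = δ := by rw [Finset.card_erase_of_mem hs, hcard]; rfl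
  have hslope := slope_le_sum (D := D) (s := s.erase h) (r := r) (a := a) (by linarith)
    (fun f hf => h0 f (Finset.mem_of_mem_erase hf)) (fun f hf => h1 f (Finset.mem_of_mem_erase hf))
  rw [hcard', ← hσ] at hslope
  have hσ2 : σ ≤ 2 := by omega
  rcases Nat.lt_or_ge 1 δ with hδ2 | hδ1
  · have hδ2' : (2 : ℝ) ≤ δ := by exact_mod_cast hδ2
    interval_cases σ <;> norm_num at hslope hgh ⊢ <;> nlinarith
  · have hδ1 : δ = 1 := by omega
    subst hδ1
    obtain ⟨x, hx⟩ := Finset.card_eq_one.1 hcard'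
    have hxs : x ∈ s := Finset.mem_of_mem_erase (hx ▸ Finset.mem_singleton_self x)
    rw [hx, Finset.sum_singleton] at hσ
    rw [hx, Finset.sum_singleton] at hslope ⊢
    interval_cases σ
    · norm_num at hslope hgh
      linarith
    · norm_num at hslope hgh
      rcases Nat.lt_or_ge 5 M with hM6 | hM5
      · have : (6 : ℝ) ≤ M := by exact_mod_cast hM6
        linarith
      · have : M = 5 := by omega
        subst this
        norm_num at hε
        norm_num at hD hgh
        linarith
    · have hx2 : (D - 2) / 3 ≤ (D - r x) / a x := by
        have h3 : (a x : ℝ) ≤ 3 := by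
          have := (h1 x hxs (by omega)).2
          exact_mod_cast (by omega : a x ≤ 3)
        have h2 : (2 : ℝ) ≤ a x := by exact_mod_cast (h1 x hxs (by omega)).1
        rw [← hσ]
        norm_num
        exact div_le_div_of_nonneg_left (by linarith) (by linarith) h3
      -- This is `(D - M + 2) / 2 + (D - 2) / 3 ≥ 0` after clearing denominators. With `δ = 1` it is
      -- an equality at `M = 5`, where `ε = 3 / 5`.
      have h7 : 13 ≤ 2 * M + 5 * ε := by
        rcases Nat.lt_or_ge 6 M with hM7 | hM6
        · have : (7 : ℝ) ≤ M := by exact_mod_cast hM7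
          linarith
        · interval_cases M <;> norm_num at hε <;> norm_num [hε]
      norm_num at hgh
      linarith

/-- Here `δ = d_v - 1`, `M = m - δ` and `D = R - δ` for a vertex `v`, while `r f` is the excess of
`f` away from `v` and `a f` counts the branch vertices of `f`. The value of `ε` is dictated by `M =
3`, that is `d_v = m - 2`: the slope bound then requires exactly `ε * (2 * δ - 1) ≥ 3`, and `2 * δ -
1 = 2 * m - 7`. -/
theorem sum_sub_div_nonneg (hm : 5 ≤ M + δ) (hM : 3 ≤ M) (hδ : 1 ≤ δ) (hcard : s.card = δ + 1)
    (hr : ∑ f ∈ s, r f ≤ M) (h0 : ∀ f ∈ s, r f = 0 → a f = 1)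
    (h1 : ∀ f ∈ s, r f ≠ 0 → 2 ≤ a f ∧ a f ≤ r f + 1) {ε D : ℝ}
    (hε : ε = 3 / (2 * (M + δ) - 7)) (hD : D = M - 3 + ε) :
    0 ≤ ∑ f ∈ s, (D - r f) / a f := by
  have hr' : ((∑ f ∈ s, r f : ℕ) : ℝ) ≤ M := by exact_mod_cast hr
  have hδ' : (1 : ℝ) ≤ δ := by exact_mod_cast hδ
  rcases Nat.lt_or_ge 4 M with hM5 | hM4
  · exact sum_sub_div_nonneg_of_five_le hM5 hδ hcard hr h0 h1 hε hD
  have hM34 : M = 3 ∨ M = 4 := by omega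
  rcases hM34 with rfl | rfl
  · have hδ2 : (2 : ℝ) ≤ δ := by exact_mod_cast (by omega : 2 ≤ δ)
    have hε' : ε * (2 * δ - 1) = 3 := by
      rw [hε]
      push_cast
      field_simp [show (2 * (3 + (δ : ℝ)) - 7) ≠ 0 by linarith]
      ring
    have hε0 : 0 < ε := by
      rw [hε]
      push_cast
      apply div_pos <;> linarith
    have hDε : D = ε := by rw [hD]; push_cast; ring
    have hslope := slope_le_sum (D := D) (s := s) (r := r) (a := a) (by linarith) h0 h1
    rw [hcard] at hslope
    push_cast at hslope hr'
    rw [hDε] at hslope ⊢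
    nlinarith
  · have hε0 : 0 < ε := by
      rw [hε]
      push_cast
      apply div_pos <;> linarith
    have hDε : D = 1 + ε := by rw [hD]; push_cast; ring
    have hε1 : ε ≤ 1 := by
      rw [hε, div_le_one (by push_cast; linarith)]
      push_cast
      linarith
    have hsum : ((δ + 1) * D - 4) / 2 ≤ ∑ f ∈ s, (D - r f) / 2 := by
      rw [← Finset.sum_div, Finset.sum_sub_distrib, Finset.sum_const, hcard, nsmul_eq_mul]
      push_cast at hr' ⊢
      linarith
    refine le_trans ?_ (hsum.trans (Finset.sum_le_sum fun f hf =>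
      half_le_sub_div (by linarith) (by linarith) (h0 f hf) (h1 f hf)))
    rcases Nat.lt_or_ge 2 δ with h3 | h2
    · have : (3 : ℝ) ≤ δ := by exact_mod_cast h3
      rw [hDε]
      nlinarith
    · interval_cases δ <;> norm_num at hε <;> norm_num [hDε, hε]

/-- For `m = 4` the general formula for the threshold would be too large. All degrees are then at
most `2`, which forces `a = r + 1`; the value `7 / 5 = 12 / 5 - 1` makes the worst case `{r x, r y}
= {1, 2}` an equality. -/
theorem sum_sub_div_nonneg_of_four (hcard : s.card = 2) (hr : ∑ f ∈ s, r f ≤ 3)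
    (h1 : ∀ f ∈ s, a f = r f + 1) : 0 ≤ ∑ f ∈ s, ((7 / 5 : ℝ) - r f) / a f := by
  obtain ⟨x, y, hxy, rfl⟩ := Finset.card_eq_two.1 hcard
  rw [Finset.sum_pair hxy] at hr ⊢
  rw [h1 x (by simp), h1 y (by simp)]
  generalize r x = p at *
  generalize r y = q at *
  have hp : p ≤ 3 := by omega
  have hq : q ≤ 3 := by omega
  interval_cases p <;> interval_cases q <;> first | omega | norm_num

end Numeric

/-! ### The bound when every degree is at most `m - 2` -/

namespace Hypergraph

variable {V : Type*} [Fintype V] {k m : ℕ} {G : Hypergraph V}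

open scoped Classical in
/-- The vertices of degree at least two in an edge. -/
noncomputable def branchVerts (G : Hypergraph V) (e : Set V) : Finset V :=
  (verts e).filter fun v => 2 ≤ G.degree v

/-- The excess `∑_{v ∈ e} (d_v - 1)` of an edge. -/
noncomputable def excess (G : Hypergraph V) (e : Set V) : ℕ := ∑ v ∈ verts e, (G.degree v - 1)

theorem excess_eq_zero (G : Hypergraph V) {e : Set V} (h : G.branchVerts e = ∅) :
    G.excess e = 0 := by
  refine Finset.sum_eq_zero fun v hv => ?_
  have := Finset.filter_eq_empty_iff.1 h hv
  omega

theorem cast_excess {e : Set V} (he : e ∈ G.edgeSet) :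
    (G.excess e : ℝ) = ∑ v ∈ verts e, ((G.degree v : ℝ) - 1) := by
  rw [excess, Nat.cast_sum]
  refine Finset.sum_congr rfl fun v hv => ?_
  rw [Nat.cast_sub (one_le_degree_of_mem he (by simpa using hv)), Nat.cast_one]

/-- Eigenvalue bound from an averaged bound on the excesses of the edges through each vertex. -/
theorem norm_eigenvalue_le_of_excess (hk : k ≠ 0) (hG : G.IsUniform k) {R : ℝ} (hR : 0 < R)
    (h : ∀ v, 2 ≤ G.degree v →
      0 ≤ ∑ f ∈ G.edgesAt v, (R - G.excess f) / (G.branchVerts f).card)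
    {z : ℂ} (hz : IsTensorEigenvalue (G.abcTensor k) z) : ‖z‖ ≤ R ^ ((1 : ℝ) / k) := by
  classical
  -- Chosen so that `1 + b * X e = excess / R`, with `b` the number of branch vertices. Labeling
  -- these by `(1 + X e) / d_v`, Bernoulli gives `(1 + X e)^b ≥ excess / R`, which is the edge
  -- condition.
  set X : Set V → ℝ := fun e => (G.excess e / R - 1) / (G.branchVerts e).card with hX
  have hX1 : ∀ e, G.branchVerts e ≠ ∅ → -1 ≤ X e := by
    intro e he
    have hc : (1 : ℝ) ≤ (G.branchVerts e).card := by
      exact_mod_cast Finset.card_pos.2 (Finset.nonempty_iff_ne_empty.2 he)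
    have : 0 ≤ (G.excess e : ℝ) / R := by positivity
    rw [hX]
    simp only
    rw [le_div_iff₀ (by linarith)]
    linarith
  refine norm_eigenvalue_le_of_labeling hk hG hR.le
    (fun v e => if 2 ≤ G.degree v then (1 / (G.degree v : ℝ)) * (1 + X e) else 1) ?_ ?_ ?_ hz
  · intro e he v hv
    split_ifs with hd
    · have := hX1 e (Finset.ne_empty_of_mem (a := v) (by simp [branchVerts, hv, hd]))
      exact mul_nonneg (by positivity) (by linarith)
    · exact zero_le_one
  · intro v
    split_ifs with hd
    · rw [← Finset.mul_sum, Finset.sum_add_distrib, Finset.sum_const, nsmul_eq_mul, mul_one,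
        ← degree_eq_card_edgesAt]
      have hd' : (0 : ℝ) < G.degree v := by exact_mod_cast (by omega : 0 < G.degree v)
      have hs : ∑ e ∈ G.edgesAt v, X e ≤ 0 := by
        have h1 : ∑ e ∈ G.edgesAt v, X e =
            -((∑ f ∈ G.edgesAt v, (R - G.excess f) / (G.branchVerts f).card) / R) := by
          rw [Finset.sum_div, ← Finset.sum_neg_distrib]
          refine Finset.sum_congr rfl fun e _ => ?_
          rw [hX]
          field_simp
          ring
        rw [h1]
        have := div_nonneg (h v hd) hR.le
        linarith
      rw [div_mul_eq_mul_div, one_mul, div_le_one hd']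
      linarith
    · rw [Finset.sum_const, nsmul_eq_mul, mul_one, ← degree_eq_card_edgesAt]
      exact_mod_cast (by omega : G.degree v ≤ 1)
  · intro e he
    have hprod : ∏ v ∈ verts e,
        (if 2 ≤ G.degree v then (1 / (G.degree v : ℝ)) * (1 + X e) else 1) =
        (1 + X e) ^ (G.branchVerts e).card / ∏ v ∈ verts e, (G.degree v : ℝ) := by
      have h1 : ∀ v ∈ verts e,
          (if 2 ≤ G.degree v then (1 / (G.degree v : ℝ)) * (1 + X e) else 1) =
          (1 / (G.degree v : ℝ)) * (if 2 ≤ G.degree v then 1 + X e else 1) := by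
        intro v hv
        have h2 := one_le_degree_of_mem he (mem_verts.1 hv)
        split_ifs with hd
        · rfl
        · have : G.degree v = 1 := by omega
          simp [this]
      rw [Finset.prod_congr rfl h1, Finset.prod_mul_distrib, ← Finset.prod_filter,
        Finset.prod_const]
      simp only [one_div, Finset.prod_inv_distrib]
      rw [inv_mul_eq_div]
      rfl
    have hd0 : 0 < ∏ v ∈ verts e, (G.degree v : ℝ) := Finset.prod_pos fun v hv => by
      exact_mod_cast one_le_degree_of_mem he (mem_verts.1 hv)
    rw [hprod, abcWeight_eq G k (hG e he), ← cast_excess he, ← mul_div_assoc]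
    refine div_le_div_of_nonneg_right ?_ hd0.le
    by_cases hb : G.branchVerts e = ∅
    · rw [excess_eq_zero G hb, hb]
      simpa using hR.le
    · have hc : ((G.branchVerts e).card : ℝ) ≠ 0 := by
        exact_mod_cast (Finset.card_pos.2 (Finset.nonempty_iff_ne_empty.2 hb)).ne'
      have hbern := one_add_mul_le_pow (a := X e) (by linarith [hX1 e hb]) (G.branchVerts e).card
      have h2 : 1 + ((G.branchVerts e).card : ℝ) * X e = G.excess e / R := by
        rw [hX]
        field_simp
        ring
      rw [h2, div_le_iff₀ hR] at hbern
      linarith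

/-- By linearity the edges through `v` are pairwise disjoint away from `v`, so no vertex is counted
twice. -/
theorem sum_excess_erase_le [DecidableEq V] (hlin : G.IsLinear) (v : V) :
    ∑ f ∈ G.edgesAt v, ∑ u ∈ (verts f).erase v, (G.degree u - 1) + (G.degree v - 1) ≤
      ∑ u, (G.degree u - 1) := by
  classical
  rw [← Finset.sum_biUnion]
  · rw [add_comm, ← Finset.sum_insert (s := (G.edgesAt v).biUnion fun f => (verts f).erase v) (a := v)
      (f := fun u => G.degree u - 1) (by simp)]
    exact Finset.sum_le_sum_of_subset (Finset.subset_univ _)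
  · intro e he f hf hef
    rw [Function.onFun, Finset.disjoint_left]
    intro u hu hu'
    simp only [Finset.mem_coe, mem_edgesAt] at he hf
    simp only [Finset.mem_erase, mem_verts] at hu hu'
    exact hu.1 (hlin e he.1 f hf.1 hef ⟨hu.2, hu'.2⟩ ⟨he.2, hf.2⟩)

/-- If every degree is at most `m - 2`, the spectral radius is small. -/
theorem norm_eigenvalue_le_abcThreshold (hk : k ≠ 0) (hm : 4 ≤ m) (hG : G.IsUniform k)
    (hlin : G.IsLinear) (hdeg : ∀ v, G.degree v + 2 ≤ m) (hsum : ∑ v, (G.degree v - 1) ≤ m)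
    {z : ℂ} (hz : IsTensorEigenvalue (G.abcTensor k) z) :
    ‖z‖ ≤ abcThreshold m ^ ((1 : ℝ) / k) := by
  classical
  have hR := abcThreshold_pos hm
  refine norm_eigenvalue_le_of_excess hk hG hR (fun v hv => ?_) hz
  set r : Set V → ℕ := fun f => ∑ u ∈ (verts f).erase v, (G.degree u - 1) with hr
  set δ := G.degree v - 1 with hδ
  have hmem : ∀ f ∈ G.edgesAt v, v ∈ verts f := fun f hf => by
    rw [mem_edgesAt] at hf
    simpa using hf.2
  have hexc : ∀ f ∈ G.edgesAt v, G.excess f = δ + r f := fun f hf =>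
    (Finset.add_sum_erase _ (fun u => G.degree u - 1) (hmem f hf)).symm
  have ha : ∀ f ∈ G.edgesAt v, (G.branchVerts f).card =
      (((verts f).erase v).filter fun u => 2 ≤ G.degree u).card + 1 := fun f hf => by
    rw [branchVerts, ← Finset.insert_erase (hmem f hf), Finset.filter_insert, if_pos hv,
      Finset.card_insert_of_notMem (by simp), Finset.insert_erase (hmem f hf)]
  have hle : ∀ f, (((verts f).erase v).filter fun u => 2 ≤ G.degree u).card ≤ r f := fun f => by
    rw [Finset.card_eq_sum_ones, Finset.sum_filter, hr]
    refine Finset.sum_le_sum fun u _ => ?_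
    split_ifs <;> omega
  have hpos : ∀ f, r f ≠ 0 →
      1 ≤ (((verts f).erase v).filter fun u => 2 ≤ G.degree u).card := fun f hf => by
    obtain ⟨u, hu, hu'⟩ := Finset.exists_ne_zero_of_sum_ne_zero hf
    exact Finset.card_pos.2 ⟨u, Finset.mem_filter.2 ⟨hu, by omega⟩⟩
  have hcard : (G.edgesAt v).card = δ + 1 := by rw [← degree_eq_card_edgesAt]; omega
  have hrs : ∑ f ∈ G.edgesAt v, r f + δ ≤ m := (sum_excess_erase_le hlin v).trans hsum
  have hvm := hdeg v
  rw [Finset.sum_congr rfl fun f hf => by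
    rw [hexc f hf, Nat.cast_add, ← sub_sub]]
  by_cases h4 : m = 4
  · subst h4
    have hδ1 : δ = 1 := by omega
    rw [abcThreshold, if_pos rfl, hδ1]
    have := sum_sub_div_nonneg_of_four (s := G.edgesAt v) (r := r)
      (a := fun f => (G.branchVerts f).card) (by omega) (by omega) fun f hf => by
        rw [ha f hf, Finset.card_eq_sum_ones, Finset.sum_filter, hr]
        congr 1
        refine Finset.sum_congr rfl fun u _ => ?_
        have := hdeg u
        split_ifs <;> omega
    norm_num at this ⊢
    exact this
  · have hmδ : m = (m - δ) + δ := by omega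
    have hcast : ((m - δ : ℕ) : ℝ) = m - δ := Nat.cast_sub (by omega)
    refine sum_sub_div_nonneg (M := m - δ) (δ := δ) (a := fun f => (G.branchVerts f).card)
      (by omega) (by omega) (by omega) hcard (by omega) (fun f hf h0 => ?_) (fun f hf h0 => ?_)
      rfl ?_
    · have := hle f
      have := ha f hf
      omega
    · have := hle f
      have := hpos f h0
      have := ha f hf
      omega
    · rw [abcThreshold, if_neg h4, hcast]
      ring_nf

end Hypergraph

/-! ### Closed chains of an incidence relation -/

section ClosedChain

variable {α β : Type*}

/-- A closed chain of the incidence relation `I`: distinct points `v_0, …, v_{l-1}` and distinct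
blocks `e_0, …, e_{l-1}` with `v_i` and `v_{i+1}` incident to `e_i`, indices modulo `l`. -/
structure IsClosedChain (I : α → β → Prop) (l : ℕ) (v : ℕ → α) (e : ℕ → β) : Prop where
  two_le : 2 ≤ l
  inj_point : ∀ i < l, ∀ j < l, v i = v j → i = j
  inj_block : ∀ i < l, ∀ j < l, e i = e j → i = j
  left : ∀ i < l, I (v i) (e i)
  right : ∀ i, i + 1 < l → I (v (i + 1)) (e i)
  last : I (v 0) (e (l - 1))

namespace IsClosedChain

variable {I J : α → β → Prop} {l : ℕ} {v : ℕ → α} {e : ℕ → β}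

theorem mono (h : IsClosedChain I l v e) (hIJ : ∀ x b, I x b → J x b) : IsClosedChain J l v e where
  two_le := h.two_le
  inj_point := h.inj_point
  inj_block := h.inj_block
  left i hi := hIJ _ _ (h.left i hi)
  right i hi := hIJ _ _ (h.right i hi)
  last := hIJ _ _ h.last

/-- The index `n` of a closed chain of length `l`, reduced once modulo `l`. -/
def wrap (l n : ℕ) : ℕ := if n < l then n else n - l

theorem right' (h : IsClosedChain I l v e) {i : ℕ} (hi : i < l) : I (v (wrap l (i + 1))) (e i) := by
  unfold wrap
  split_ifs with h1
  · exact h.right i h1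
  · have : i = l - 1 := by omega
    subst this
    rw [show l - 1 + 1 - l = 0 by omega]
    exact h.last

/-- An arc of a closed chain whose extreme blocks share a point off the arc is closed up by that
point. -/
theorem shortcut (h : IsClosedChain I l v e) {s n : ℕ} (hs : s < l) (hn : 2 ≤ n) (hnl : n ≤ l)
    {x : α} (hx1 : I x (e s)) (hx2 : I x (e (wrap l (s + n - 1))))
    (hx : ∀ t, 1 ≤ t → t < n → v (wrap l (s + t)) ≠ x) :
    IsClosedChain I n (fun t => if t = 0 then x else v (wrap l (s + t)))
      (fun t => e (wrap l (s + t))) where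
  two_le := hn
  inj_point := by
    intro i hi j hj hij
    split_ifs at hij with h1 h2 h2
    · omega
    · exact absurd hij.symm (hx j (by omega) hj)
    · exact absurd hij (hx i (by omega) hi)
    · have := h.inj_point _ (by unfold wrap; split_ifs <;> omega) _
        (by unfold wrap; split_ifs <;> omega) hij
      unfold wrap at this
      split_ifs at this <;> omega
  inj_block := by
    intro i hi j hj hij
    have := h.inj_block _ (by unfold wrap; split_ifs <;> omega) _
      (by unfold wrap; split_ifs <;> omega) hij
    unfold wrap at this
    split_ifs at this <;> omega
  left := by
    intro i hi
    split_ifs with h1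
    · subst h1
      simpa [wrap, hs] using hx1
    · exact h.left _ (by unfold wrap; split_ifs <;> omega)
  right := by
    intro i hi
    simp only [Nat.add_eq_zero_iff, one_ne_zero, and_false, if_false]
    have hlt : wrap l (s + i) < l := by unfold wrap; split_ifs <;> omega
    have := h.right' hlt
    rwa [show wrap l (wrap l (s + i) + 1) = wrap l (s + (i + 1)) by
      unfold wrap; split_ifs <;> omega] at this
  last := by
    simp only [if_true]
    rwa [← Nat.add_sub_assoc (by omega)]

theorem rotate (h : IsClosedChain I l v e) {s : ℕ} (hs : s < l) :
    IsClosedChain I l (fun t => v (wrap l (s + t))) (fun t => e (wrap l (s + t))) := by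
  have h2 := h.two_le
  have h1 := h.shortcut hs h2 le_rfl (x := v s) (h.left s hs) (by
    have := h.right' (i := wrap l (s + l - 1)) (by unfold wrap; split_ifs <;> omega)
    rwa [show wrap l (wrap l (s + l - 1) + 1) = s by unfold wrap; split_ifs <;> omega] at this)
    (fun t ht1 ht2 heq => by
      have := h.inj_point _ (by unfold wrap; split_ifs <;> omega) _ hs heq
      unfold wrap at this
      split_ifs at this <;> omega)
  have h3 : (fun t => if t = 0 then v s else v (wrap l (s + t))) = fun t => v (wrap l (s + t)) := by
    funext t
    split_ifs with ht
    · subst ht; simp [wrap, hs]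
    · rfl
  rwa [h3] at h1

/-- In a shortest closed chain, blocks that are not cyclically consecutive share no point. -/
theorem not_share_of_minimal (h : IsClosedChain I l v e)
    (hmin : ∀ n v' e', IsClosedChain I n v' e' → l ≤ n) {i j : ℕ} (hij : i + 1 < j) (hj : j < l)
    (h0 : ¬(i = 0 ∧ j = l - 1)) {x : α} (hxi : I x (e i)) (hxj : I x (e j)) : False := by
  -- The common point `x` closes up both arcs between the blocks `i` and `j`. The arc used is one
  -- whose inner points avoid `x`; either one is shorter than the whole chain.
  by_cases hx : ∃ t, i < t ∧ t ≤ j ∧ v t = x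
  · obtain ⟨t, ht1, ht2, rfl⟩ := hx
    have := hmin _ _ _ (h.shortcut (s := j) (n := l - j + i + 1) (x := v t) hj (by omega) (by omega)
      hxj (by
        rwa [show wrap l (j + (l - j + i + 1) - 1) = i by unfold wrap; split_ifs <;> omega])
      fun t' h1 h2 heq => by
        have := h.inj_point _ (by unfold wrap; split_ifs <;> omega) _ (by omega) heq
        unfold wrap at this
        split_ifs at this <;> omega)
    omega
  · push Not at hx
    have := hmin _ _ _ (h.shortcut (s := i) (n := j - i + 1) (x := x) (by omega) (by omega) (by omega)
      hxi (by
        rwa [show wrap l (i + (j - i + 1) - 1) = j by unfold wrap; split_ifs <;> omega])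
      fun t' h1 h2 => by
        rw [show wrap l (i + t') = i + t' by unfold wrap; split_ifs <;> omega]
        exact hx _ (by omega) (by omega))
    omega

end IsClosedChain

/-- The bipartite graph of an incidence relation. -/
def incidenceGraph (I : α → β → Prop) : SimpleGraph (α ⊕ β) where
  Adj p q := (∃ x b, p = Sum.inl x ∧ q = Sum.inr b ∧ I x b) ∨
    (∃ x b, q = Sum.inl x ∧ p = Sum.inr b ∧ I x b)
  symm := ⟨fun _ _ h => h.symm⟩
  loopless := ⟨fun p h => by
    rcases h with ⟨x, b, h1, h2, -⟩ | ⟨x, b, h1, h2, -⟩ <;> simp [h1] at h2⟩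

/-- A closed walk in a bipartite graph alternates between the two sides, so `n` is even; the even
positions give the points and the odd ones the blocks. -/
theorem exists_isClosedChain_of_periodic {I : α → β → Prop} {n : ℕ} (hn : 3 ≤ n)
    {g : ℕ → α ⊕ β} (hper : g n = g 0) (hinj : ∀ i < n, ∀ j < n, g i = g j → i = j)
    (hadj : ∀ i, (incidenceGraph I).Adj (g i) (g (i + 1))) (h0 : (g 0).isLeft) :
    ∃ l v e, IsClosedChain I l v e := by
  have hstep : ∀ i, (g i).isLeft ↔ (g (i + 1)).isRight := fun i => by
    rcases hadj i with ⟨x, b, h1, h2, -⟩ | ⟨x, b, h1, h2, -⟩ <;> simp [h1, h2]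
  have hpar : ∀ i, (g (2 * i)).isLeft := fun i => by
    induction i with
    | zero => exact h0
    | succ i ih =>
      have h1 := (hstep (2 * i)).1 ih
      have h2 := hstep (2 * i + 1)
      rw [show 2 * (i + 1) = 2 * i + 1 + 1 by ring]
      by_contra h3
      rw [Sum.not_isLeft] at h3
      have := h2.2 h3
      rw [← Sum.not_isLeft] at h1
      exact h1 this
  have hpar' : ∀ i, (g (2 * i + 1)).isRight := fun i => (hstep _).1 (hpar i)
  have heven : n % 2 = 0 := by
    by_contra h
    have h1 := hpar' (n / 2)
    rw [show 2 * (n / 2) + 1 = n by omega, hper, ← Sum.not_isLeft] at h1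
    exact h1 h0
  choose v hv using fun i => Sum.isLeft_iff.1 (hpar i)
  choose e he using fun i => Sum.isRight_iff.1 (hpar' i)
  have hI : ∀ i j k, (i = 2 * j ∧ i + 1 = 2 * k + 1) → I (v j) (e k) := fun i j k h => by
    have h1 := hadj i
    rw [h.2, h.1, hv, he] at h1
    rcases h1 with ⟨x, b, h1, h2, h3⟩ | ⟨x, b, h1, h2, h3⟩
    · rw [Sum.inl.inj h1, Sum.inr.inj h2]; exact h3
    · simp at h1
  have hI' : ∀ i, I (v (i + 1)) (e i) := fun i => by
    have h1 := hadj (2 * i + 1)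
    rw [show 2 * i + 1 + 1 = 2 * (i + 1) by ring, hv, he] at h1
    rcases h1 with ⟨x, b, h1, h2, h3⟩ | ⟨x, b, h1, h2, h3⟩
    · simp at h1
    · rw [Sum.inl.inj h1, Sum.inr.inj h2]; exact h3
  refine ⟨n / 2, v, e, by omega, fun i hi j hj h => ?_, fun i hi j hj h => ?_, fun i _ => ?_,
    fun i _ => hI' i, ?_⟩
  · have := hinj (2 * i) (by omega) (2 * j) (by omega) (by rw [hv, hv, h])
    omega
  · have := hinj (2 * i + 1) (by omega) (2 * j + 1) (by omega) (by rw [he, he, h])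
    omega
  · exact hI (2 * i) i i ⟨rfl, rfl⟩
  · have h1 := hI' (n / 2 - 1)
    have h2 : v (n / 2 - 1 + 1) = v 0 := by
      have := hv (n / 2 - 1 + 1)
      rw [show 2 * (n / 2 - 1 + 1) = n by omega, hper, show (0 : ℕ) = 2 * 0 from rfl, hv 0] at this
      exact (Sum.inl.inj this).symm
    rwa [h2] at h1

theorem isAcyclic_incidenceGraph {I : α → β → Prop}
    (h : ∀ l v e, ¬IsClosedChain I l v e) : (incidenceGraph I).IsAcyclic := by
  rw [SimpleGraph.isAcyclic_iff_free_cycleGraph]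
  rintro n hn ⟨f⟩
  obtain ⟨n, rfl⟩ := Nat.exists_eq_add_of_le' (by omega : 2 ≤ n)
  have hadj : ∀ t : ℕ,
      (SimpleGraph.cycleGraph (n + 2)).Adj (Fin.ofNat (n + 2) t) (Fin.ofNat (n + 2) (t + 1)) := by
    intro t
    have : Fin.ofNat (n + 2) (t + 1) = Fin.ofNat (n + 2) t + 1 := by
      ext
      simp [Fin.val_add]
    rw [SimpleGraph.cycleGraph_adj, this]
    right
    rw [add_sub_cancel_left]
  have key : ∀ s : ℕ, (f (Fin.ofNat (n + 2) s)).isLeft → False := fun s hs => by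
    have hper : f (Fin.ofNat (n + 2) (s + (n + 2))) = f (Fin.ofNat (n + 2) (s + 0)) := by
      congr 1
      ext
      simp
    obtain ⟨l, v, e, hc⟩ := exists_isClosedChain_of_periodic (I := I) (n := n + 2) hn
      (g := fun t => f (Fin.ofNat (n + 2) (s + t))) hper (fun i hi j hj hij => by
        have := congrArg Fin.val (f.injective hij)
        have h1 : s + i ≡ s + j [MOD n + 2] := this
        have h2 := Nat.ModEq.add_left_cancel' s h1
        rwa [Nat.ModEq, Nat.mod_eq_of_lt hi, Nat.mod_eq_of_lt hj] at h2)
      (fun i => f.toHom.map_adj (hadj (s + i))) hs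
    exact h l v e hc
  -- If the cycle starts at a block, it is read from its next vertex, which is a point.
  rcases h0 : f (Fin.ofNat (n + 2) 0) with x | b
  · exact key 0 (by rw [h0]; rfl)
  · refine key 1 ?_
    have : (incidenceGraph I).Adj (f (Fin.ofNat (n + 2) 0)) (f (Fin.ofNat (n + 2) 1)) :=
      f.toHom.map_adj (hadj 0)
    rcases this with ⟨x, b, h1, h2, -⟩ | ⟨x, b, h1, h2, -⟩
    · rw [h1] at h0; simp at h0
    · rw [h1]; rfl

open scoped Classical in
/-- An incidence relation without closed chains has few incidences. -/
theorem card_incidence_lt [Fintype α] [Fintype β] [Nonempty α] {I : α → β → Prop}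
    (h : ∀ l v e, ¬IsClosedChain I l v e) :
    (Finset.univ.filter fun p : α × β => I p.1 p.2).card < Fintype.card α + Fintype.card β := by
  -- The acyclic incidence graph extends to a spanning tree of the complete graph on points and
  -- blocks. The incidences inject into its edges, whose number is one less than that of its
  -- vertices.
  obtain ⟨F, hF, -, hT⟩ := (SimpleGraph.connected_top (V := α ⊕ β)).exists_isTree_le_of_le_of_isAcyclic
    (le_top : incidenceGraph I ≤ ⊤) (isAcyclic_incidenceGraph h)
  have h1 := hT.card_edgeFinset
  rw [Fintype.card_sum] at h1
  rw [← h1, Nat.lt_succ_iff]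
  refine Finset.card_le_card_of_injOn (fun p => s(Sum.inl p.1, Sum.inr p.2)) ?_ ?_
  · intro p hp
    simp only [Finset.coe_filter, Finset.mem_univ, true_and, Set.mem_ofPred_eq] at hp
    simp only [SimpleGraph.coe_edgeFinset, SimpleGraph.mem_edgeSet]
    exact hF (Or.inl ⟨p.1, p.2, rfl, rfl, hp⟩)
  · intro p _ q _ hpq
    simpa [Sym2.eq_iff, Prod.ext_iff] using hpq

end ClosedChain

/-! ### Cycles and the degree sum of a unicyclic hypergraph -/

namespace Hypergraph

open IsClosedChain

section Cycles

variable {V : Type*} {G : Hypergraph V}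

/-- A chordless closed chain of vertices and edges is a cycle. -/
theorem isCycle_of_isClosedChain {l : ℕ} {v : ℕ → V} {e : ℕ → G.edgeSet}
    (h : IsClosedChain (fun x b => x ∈ b.1) l v e)
    (hdisj : ∀ i j, i + 1 < j → j < l → ¬(i = 0 ∧ j = l - 1) →
      ∀ x, x ∈ (e i).1 → x ∈ (e j).1 → False) :
    G.IsCycle (v '' Set.Iio l) ((fun i => (e i).1) '' Set.Iio l) := by
  have h2 := h.two_le
  obtain ⟨n, rfl⟩ := Nat.exists_eq_add_of_le' (by omega : 1 ≤ l)
  have hrot : ∀ i : Fin (n + 1), ((finRotate (n + 1) i : Fin (n + 1)) : ℕ) =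
      wrap (n + 1) (i + 1) := fun i => by
    rw [coe_finRotate]
    have := i.2
    unfold wrap
    split_ifs with h1 h3 h3
    · rw [h1, Fin.val_last] at h3; omega
    · rw [h1, Fin.val_last]; omega
    · rfl
    · exact absurd (Fin.ext (by rw [Fin.val_last]; omega)) h1
  refine ⟨n + 1, fun i => v i, fun i => (e i).1, h2, fun i j hij => ?_, fun i j hij => ?_,
    fun i => ⟨(e i).2, h.left i i.2, ?_⟩, fun i j h1 h3 h4 => ?_, ?_, ?_⟩
  · exact Fin.ext (h.inj_point i i.2 j j.2 hij)
  · exact Fin.ext (h.inj_block i i.2 j j.2 (Subtype.ext hij))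
  · simp only [hrot]
    exact h.right' i.2
  · have key : ∀ i j : Fin (n + 1), i < j → j ≠ finRotate (n + 1) i → i ≠ finRotate (n + 1) j →
        Disjoint (e i).1 (e j).1 := by
      intro i j hij h3 h4
      rw [Ne, Fin.ext_iff, hrot] at h3 h4
      rw [Set.disjoint_left]
      intro x hxi hxj
      have hij' : (i : ℕ) < j := hij
      have hj := j.2
      refine hdisj i j ?_ j.2 ?_ x hxi hxj
      · unfold wrap at h3
        split_ifs at h3 <;> omega
      · rintro ⟨h5, h6⟩
        unfold wrap at h4
        split_ifs at h4 <;> omega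
    rcases lt_or_gt_of_ne h1 with h5 | h5
    · exact key i j h5 h3 h4
    · exact (key j i h5 h4 h3).symm
  · ext x
    constructor
    · rintro ⟨i, hi, rfl⟩; exact ⟨⟨i, hi⟩, rfl⟩
    · rintro ⟨i, rfl⟩; exact ⟨i, i.2, rfl⟩
  · ext x
    constructor
    · rintro ⟨i, hi, rfl⟩; exact ⟨⟨i, hi⟩, rfl⟩
    · rintro ⟨i, rfl⟩; exact ⟨i, i.2, rfl⟩

theorem IsLinear.eq_of_mem (hlin : G.IsLinear) {e f : Set V} (he : e ∈ G.edgeSet)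
    (hf : f ∈ G.edgeSet) (hef : e ≠ f) {x y : V} (hx : x ∈ e) (hx' : x ∈ f) (hy : y ∈ e)
    (hy' : y ∈ f) : x = y :=
  hlin e he f hf hef ⟨hx, hx'⟩ ⟨hy, hy'⟩

/-- In a linear hypergraph with only one cycle, deleting an incidence of the cycle destroys all
closed chains. -/
theorem not_isClosedChain_of_unique (hlin : G.IsLinear) {S : Set V} {F : Set (Set V)}
    (huniq : ∀ S' F', G.IsCycle S' F' → S' = S ∧ F' = F) {a : V} {b : G.edgeSet} (haS : a ∈ S)
    (hbF : b.1 ∈ F) (hab : a ∈ b.1) (l : ℕ) (v : ℕ → V) (e : ℕ → G.edgeSet) :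
    ¬IsClosedChain (fun x (c : G.edgeSet) => x ∈ c.1 ∧ ¬(x = a ∧ c = b)) l v e := by
  classical
  intro hchain
  set I : V → G.edgeSet → Prop := fun x c => x ∈ c.1 ∧ ¬(x = a ∧ c = b) with hI
  have hex : ∃ l v e, IsClosedChain I l v e := ⟨l, v, e, hchain⟩
  clear hchain
  obtain ⟨v, e, h⟩ := Nat.find_spec hex
  have hmin : ∀ n v' e', IsClosedChain I n v' e' → Nat.find hex ≤ n := fun n v' e' h' =>
    Nat.find_min' hex ⟨v', e', h'⟩
  generalize Nat.find hex = l at h hmin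
  have hmono : ∀ x c, I x c → x ∈ c.1 := fun x c hx => hx.1
  -- The chain is a shortest one avoiding the deleted incidence, so a chord can only use that
  -- incidence: the shared point is `a` and one of the two edges is `b`.
  have hchord : ∀ {v e}, IsClosedChain I l v e → ∀ i j, i + 1 < j → j < l →
      ¬(i = 0 ∧ j = l - 1) → ∀ x, x ∈ (e i).1 → x ∈ (e j).1 → x = a ∧ (e i = b ∨ e j = b) := by
    intro v e h i j h1 h2 h3 x hxi hxj
    by_contra hc
    exact h.not_share_of_minimal hmin h1 h2 h3 (x := x)
      ⟨hxi, fun hx => hc ⟨hx.1, Or.inl hx.2⟩⟩ ⟨hxj, fun hx => hc ⟨hx.1, Or.inr hx.2⟩⟩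
  -- Otherwise the chain is chordless, hence a cycle of `G` whose edge set misses `b`. The chain is
  -- then rotated so that `b` is the edge `e 0`.
  have hb : ∃ s < l, e s = b := by
    by_contra hb
    push Not at hb
    have hcyc := isCycle_of_isClosedChain (h.mono hmono) fun i j h1 h2 h3 x hxi hxj => by
      rcases (hchord h i j h1 h2 h3 x hxi hxj).2 with h4 | h4
      · exact hb i (by omega) h4
      · exact hb j h2 h4
    obtain ⟨s, hs, hs'⟩ := (huniq _ _ hcyc).2 ▸ hbF
    exact hb s hs (Subtype.ext hs')
  obtain ⟨s, hs, hsb⟩ := hb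
  replace h := h.rotate hs
  set v' := fun t => v (wrap l (s + t)) with hv'
  set e' := fun t => e (wrap l (s + t)) with he'
  have he0 : e' 0 = b := by simp [he', wrap, hs, hsb]
  clear_value v' e'
  clear hv' he' hsb hs s v e
  rename' v' => v, e' => e
  have hl := h.two_le
  have hv0 : v 0 ≠ a := fun h0 => (h.left 0 (by omega)).2 ⟨h0, he0⟩
  have hv1 : v 1 ≠ a := fun h0 => (h.right 0 (by omega)).2 ⟨h0, he0⟩
  have hne : ∀ i < l, ∀ j < l, i ≠ j → (e i).1 ≠ (e j).1 := fun i hi j hj hij h1 =>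
    hij (h.inj_block i hi j hj (Subtype.ext h1))
  -- If no other edge of the chain contains `a`, the chain is a chordless cycle, so `a` must be one
  -- of its vertices; being neither `v 0` nor `v 1`, it lies on another edge after all.
  by_cases hJ : ∃ j, 1 ≤ j ∧ j < l ∧ a ∈ (e j).1 ∧ a ∈ (e 0).1
  swap
  · push Not at hJ
    have hcyc := isCycle_of_isClosedChain (h.mono hmono) fun i j h1 h2 h3 x hxi hxj => by
      obtain ⟨rfl, h4⟩ := hchord h i j h1 h2 h3 x hxi hxj
      rcases h4 with h4 | h4
      · rw [← he0] at h4
        have := h.inj_block i (by omega) 0 (by omega) h4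
        subst this
        exact hJ j (by omega) h2 hxj hxi
      · rw [← he0] at h4
        have := h.inj_block j (by omega) 0 (by omega) h4
        omega
    have haS' := haS
    rw [← (huniq _ _ hcyc).1] at haS'
    obtain ⟨t, ht, rfl⟩ := haS'
    have ht : t < l := ht
    have ht0 : t ≠ 0 := fun h0 => hv0 (by rw [h0])
    rw [← he0] at hab
    exact hJ t (by omega) ht (h.left t ht).1 hab
  · obtain ⟨j0, hj01, hj0l, haj0, ha0⟩ := hJ
    -- Linearity keeps `a` off the two neighbours of `e 0`. With `p` and `q` the first and last
    -- positive indices of edges containing `a`, restoring the incidence splits the chain into two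
    -- cycles through `e 0`.
    have hnot1 : a ∉ (e 1).1 := fun h1 => hv1
      (hlin.eq_of_mem (e 0).2 (e 1).2 (hne 0 (by omega) 1 (by omega) (by omega))
        (h.right 0 (by omega)).1 (h.left 1 (by omega)).1 ha0 h1)
    have hnotlast : a ∉ (e (l - 1)).1 := fun h1 => hv0
      (hlin.eq_of_mem (e 0).2 (e (l - 1)).2 (hne 0 (by omega) (l - 1) (by omega) (by omega))
        (h.left 0 (by omega)).1 h.last.1 ha0 h1)
    have hJex : ∃ j, 1 ≤ j ∧ j < l ∧ a ∈ (e j).1 := ⟨j0, hj01, hj0l, haj0⟩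
    obtain ⟨hp1, hpl, hpa⟩ := Nat.find_spec hJex
    have hpmin : ∀ j, 1 ≤ j → j < l → a ∈ (e j).1 → Nat.find hJex ≤ j := fun j h1 h2 h3 =>
      Nat.find_min' hJex ⟨h1, h2, h3⟩
    generalize Nat.find hJex = p at hp1 hpl hpa hpmin
    -- The last index is obtained as the least distance from `l`.
    have hJex' : ∃ j, 1 ≤ l - j ∧ l - j < l ∧ a ∈ (e (l - j)).1 :=
      ⟨l - j0, by omega, by omega, by rwa [show l - (l - j0) = j0 by omega]⟩
    obtain ⟨hq1, hql, hqa⟩ := Nat.find_spec hJex'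
    have hqmin : ∀ j, 1 ≤ j → j < l → a ∈ (e j).1 → j ≤ l - Nat.find hJex' := fun j h1 h2 h3 => by
      have := Nat.find_min' hJex' (m := l - j)
        ⟨by omega, by omega, by rwa [show l - (l - j) = j by omega]⟩
      omega
    generalize l - Nat.find hJex' = q at hq1 hql hqa hqmin
    clear hJex hJex'
    have hp2 : p ≠ 1 := fun h1 => hnot1 (h1 ▸ hpa)
    have hq2 : q ≠ l - 1 := fun h1 => hnotlast (h1 ▸ hqa)
    have hpq := hpmin q hq1 hql hqa
    have hv : ∀ t, 1 ≤ t → t < l → v t = a → a ∈ (e t).1 ∧ a ∈ (e (t - 1)).1 := fun t h1 h2 h3 => by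
      refine ⟨h3 ▸ (h.left t h2).1, ?_⟩
      have := (h.right (t - 1) (by omega)).1
      rwa [show t - 1 + 1 = t by omega, h3] at this
    have hc1 := (h.mono hmono).shortcut (s := 0) (n := p + 1) (x := a) (by omega) (by omega)
      (by omega) ha0 (by rwa [show wrap l (0 + (p + 1) - 1) = p by unfold wrap; split_ifs <;> omega])
      fun t h1 h2 h3 => by
        rw [show wrap l (0 + t) = t by unfold wrap; split_ifs <;> omega] at h3
        have h4 := (hv t h1 (by omega) h3).2
        rcases Nat.eq_or_lt_of_le h1 with rfl | h5
        · exact hv1 h3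
        · have := hpmin (t - 1) (by omega) (by omega) h4
          omega
    have hc2 := (h.mono hmono).shortcut (s := q) (n := l - q + 1) (x := a) (by omega) (by omega)
      (by omega) hqa (by rwa [show wrap l (q + (l - q + 1) - 1) = 0 by unfold wrap; split_ifs <;> omega])
      fun t h1 h2 h3 => by
        rcases Nat.lt_or_ge (q + t) l with h5 | h5
        · rw [show wrap l (q + t) = q + t by unfold wrap; split_ifs <;> omega] at h3
          have := hqmin (q + t) (by omega) (by omega) (hv (q + t) (by omega) h5 h3).1
          omega
        · rw [show wrap l (q + t) = 0 by unfold wrap; split_ifs <;> omega] at h3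
          exact hv0 h3
    have hcyc1 := isCycle_of_isClosedChain hc1 fun i j h1 h2 h3 x hxi hxj => by
      rw [show wrap l (0 + i) = i by unfold wrap; split_ifs <;> omega] at hxi
      rw [show wrap l (0 + j) = j by unfold wrap; split_ifs <;> omega] at hxj
      obtain ⟨rfl, h4⟩ := hchord h i j h1 (by omega) (by omega) x hxi hxj
      have := hpmin j (by omega) (by omega) hxj
      rcases h4 with h4 | h4
      · have := h.inj_block i (by omega) 0 (by omega) (by rw [h4, he0])
        omega
      · have := h.inj_block j (by omega) 0 (by omega) (by rw [h4, he0])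
        omega
    have hcyc2 := isCycle_of_isClosedChain hc2 fun i j h1 h2 h3 x hxi hxj => by
      rw [show wrap l (q + i) = q + i by unfold wrap; split_ifs <;> omega] at hxi
      rcases Nat.lt_or_ge (q + j) l with h5 | h5
      · rw [show wrap l (q + j) = q + j by unfold wrap; split_ifs <;> omega] at hxj
        obtain ⟨rfl, h4⟩ := hchord h (q + i) (q + j) (by omega) (by omega) (by omega) x hxi hxj
        rcases h4 with h4 | h4
        · have := h.inj_block (q + i) (by omega) 0 (by omega) (by rw [h4, he0])
          omega
        · have := h.inj_block (q + j) (by omega) 0 (by omega) (by rw [h4, he0])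
          omega
      · rw [show wrap l (q + j) = 0 by unfold wrap; split_ifs <;> omega] at hxj
        obtain ⟨rfl, h4⟩ := hchord h 0 (q + i) (by omega) (by omega) (by omega) x hxj hxi
        have := hqmin (q + i) (by omega) (by omega) hxi
        omega
    -- The two cycles would have the same edges, but `e 1` belongs only to the first, since `2 ≤ p ≤
    -- q`.
    have hF := (huniq _ _ hcyc1).2.trans (huniq _ _ hcyc2).2.symm
    have hmem : (e 1).1 ∈ (fun i => (e (wrap l (0 + i))).1) '' Set.Iio (p + 1) :=
      ⟨1, by simp only [Set.mem_Iio]; omega, by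
        simp only [show wrap l (0 + 1) = 1 by unfold wrap; split_ifs <;> omega]⟩
    rw [hF] at hmem
    obtain ⟨t, ht, ht'⟩ := hmem
    have ht : t < l - q + 1 := ht
    have := h.inj_block _ (by unfold wrap; split_ifs <;> omega) 1 (by omega) (Subtype.ext ht')
    unfold wrap at this
    split_ifs at this <;> omega

theorem IsConnected.exists_edge (hconn : G.IsConnected) (hV : G.vertexSet = Set.univ) {x y : V}
    (hxy : x ≠ y) : ∃ e ∈ G.edgeSet, x ∈ e := by
  obtain ⟨l, v, e, -, -, h, -, h0, h1⟩ := hconn x (by simp [hV]) y (by simp [hV])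
  rcases Nat.eq_zero_or_pos l with rfl | hl
  · exact absurd (h0.symm.trans h1) hxy
  · obtain ⟨h2, h3, -⟩ := h ⟨0, hl⟩
    exact ⟨_, h2, by rw [← h0]; exact h3⟩

variable [Fintype V]

theorem IsUnicyclic.one_le_degree (huni : G.IsUnicyclic) (hV : G.vertexSet = Set.univ) (x : V) :
    1 ≤ G.degree x := by
  obtain ⟨hconn, C, ⟨l, v, e, hl, hv, -⟩, -⟩ := huni
  have : ∃ y, x ≠ y := by
    by_contra h
    push Not at h
    have h1 := (h (v ⟨0, by omega⟩)).symm.trans (h (v ⟨1, by omega⟩))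
    simpa using hv h1
  obtain ⟨y, hy⟩ := this
  obtain ⟨e, he, hx⟩ := hconn.exists_edge hV hy
  exact one_le_degree_of_mem he hx

open scoped Classical in
theorem sum_degree_eq_card_incidence (G : Hypergraph V) :
    ∑ x, G.degree x =
      (Finset.univ.filter fun p : V × G.edgeSet => p.1 ∈ p.2.1).card := by
  rw [Finset.card_filter, Fintype.sum_prod_type]
  refine Finset.sum_congr rfl fun x _ => ?_
  rw [← Finset.card_filter, degree_eq_card_edgesAt]
  refine (Finset.card_bij (fun c _ => c.1) (fun c hc => ?_) (fun c _ d _ h => Subtype.ext h)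
    fun e he => ?_).symm
  · simp only [Finset.mem_filter, Finset.mem_univ, true_and] at hc
    exact mem_edgesAt.2 ⟨c.2, hc⟩
  · rw [mem_edgesAt] at he
    exact ⟨⟨e, he.1⟩, by simpa using he.2, rfl⟩

/-- In a linear unicyclic hypergraph, the excesses of the degrees sum up to at most the number of
edges. -/
theorem IsUnicyclic.sum_degree_sub_one_le (huni : G.IsUnicyclic) (hlin : G.IsLinear)
    (hV : G.vertexSet = Set.univ) : ∑ x, (G.degree x - 1) ≤ G.edgeSet.ncard := by
  classical
  have hdeg := huni.one_le_degree hV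
  obtain ⟨-, ⟨S, F⟩, hC, huniq⟩ := huni
  have huniq' : ∀ S' F', G.IsCycle S' F' → S' = S ∧ F' = F := fun S' F' h => by
    simpa using huniq (S', F') h
  obtain ⟨l, v, e, hl, -, -, he, -, hS, hF⟩ := hC
  simp only at hS hF
  set i : Fin l := ⟨0, by omega⟩
  obtain ⟨h1, h2, -⟩ := he i
  have : Nonempty V := ⟨v i⟩
  -- Deleting one incidence of the cycle leaves fewer than `|V| + |E|` incidences; restoring it
  -- gives `∑ d ≤ |V| + |E|`.
  have hlt : (Finset.univ.filter fun p : V × G.edgeSet =>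
      p.1 ∈ p.2.1 ∧ ¬(p.1 = v i ∧ p.2 = ⟨e i, h1⟩)).card <
      Fintype.card V + Fintype.card G.edgeSet := by
    convert card_incidence_lt (not_isClosedChain_of_unique hlin huniq' (a := v i) (b := ⟨e i, h1⟩)
      (by rw [hS]; exact ⟨i, rfl⟩) (by rw [hF]; exact ⟨i, rfl⟩) h2)
  have hins : (Finset.univ.filter fun p : V × G.edgeSet => p.1 ∈ p.2.1) =
      insert (v i, ⟨e i, h1⟩) (Finset.univ.filter fun p : V × G.edgeSet =>
        p.1 ∈ p.2.1 ∧ ¬(p.1 = v i ∧ p.2 = ⟨e i, h1⟩)) := by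
    ext ⟨x, c⟩
    simp only [Finset.mem_filter, Finset.mem_univ, true_and, Finset.mem_insert, Prod.mk.injEq]
    constructor
    · intro h
      by_cases h' : x = v i ∧ c = ⟨e i, h1⟩
      · exact Or.inl h'
      · exact Or.inr ⟨h, h'⟩
    · rintro (⟨rfl, rfl⟩ | h)
      · exact h2
      · exact h.1
  have hsum := sum_degree_eq_card_incidence G
  rw [hins, Finset.card_insert_of_notMem (by simp)] at hsum
  have hsub : ∑ x, (G.degree x - 1) + Fintype.card V = ∑ x, G.degree x := by
    rw [← Finset.card_univ, Finset.card_eq_sum_ones, ← Finset.sum_add_distrib]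
    exact Finset.sum_congr rfl fun x _ => Nat.sub_add_cancel (hdeg x)
  have hE : Fintype.card G.edgeSet = G.edgeSet.ncard := by
    rw [← Nat.card_eq_fintype_card]; rfl
  omega

end Cycles

end Hypergraph

/-! ### Hypergraphs with a vertex on all edges but one -/

theorem isClosedChain_three {α β : Type*} {I : α → β → Prop} {x₀ x₁ x₂ : α} {b₀ b₁ b₂ : β}
    (hx₀₁ : x₀ ≠ x₁) (hx₀₂ : x₀ ≠ x₂) (hx₁₂ : x₁ ≠ x₂) (hb₀₁ : b₀ ≠ b₁) (hb₀₂ : b₀ ≠ b₂)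
    (hb₁₂ : b₁ ≠ b₂) (h₀ : I x₀ b₀) (h₀' : I x₁ b₀) (h₁ : I x₁ b₁) (h₁' : I x₂ b₁) (h₂ : I x₂ b₂)
    (h₂' : I x₀ b₂) :
    IsClosedChain I 3 (fun i => if i = 0 then x₀ else if i = 1 then x₁ else x₂)
      (fun i => if i = 0 then b₀ else if i = 1 then b₁ else b₂) where
  two_le := by omega
  inj_point i hi j hj hij := by
    interval_cases i <;> interval_cases j <;> simp at hij ⊢ <;>
      first | exact hx₀₁ hij | exact hx₀₂ hij | exact hx₁₂ hij | exact hx₀₁ hij.symm |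
        exact hx₀₂ hij.symm | exact hx₁₂ hij.symm
  inj_block i hi j hj hij := by
    interval_cases i <;> interval_cases j <;> simp at hij ⊢ <;>
      first | exact hb₀₁ hij | exact hb₀₂ hij | exact hb₁₂ hij | exact hb₀₁ hij.symm |
        exact hb₀₂ hij.symm | exact hb₁₂ hij.symm
  left i hi := by
    interval_cases i
    exacts [h₀, h₁, h₂]
  right i hi := by
    have hi : i < 2 := by omega
    interval_cases i
    exacts [h₀', h₁']
  last := h₂'

namespace Hypergraph

open IsClosedChain

section Sun

variable {V : Type*} {G : Hypergraph V}

theorem IsCycle.exists_isClosedChain {S : Set V} {F : Set (Set V)} (h : G.IsCycle S F) :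
    ∃ (l : ℕ) (v : ℕ → V) (e : ℕ → G.edgeSet), IsClosedChain (fun x b => x ∈ b.1) l v e ∧
      (∀ i j, i + 1 < j → j < l → ¬(i = 0 ∧ j = l - 1) → Disjoint (e i).1 (e j).1) ∧
      F = (fun i => (e i).1) '' Set.Iio l := by
  obtain ⟨l, v, e, hl, hv, he, h, hdisj, -, rfl⟩ := h
  obtain ⟨n, rfl⟩ := Nat.exists_eq_add_of_le' (by omega : 1 ≤ l)
  have hrot : ∀ i : Fin (n + 1), finRotate (n + 1) i = Fin.ofNat (n + 1) (i + 1) := fun i => by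
    ext
    rw [coe_finRotate]
    have := i.2
    split_ifs with h1
    · simp [h1]
    · have : (i : ℕ) ≠ n := fun h2 => h1 (Fin.ext (by rw [Fin.val_last]; exact h2))
      simp only [Fin.ofNat]
      rw [Nat.mod_eq_of_lt (by omega)]
  have hval : ∀ i < n + 1, ((Fin.ofNat (n + 1) i : Fin (n + 1)) : ℕ) = i := fun i hi =>
    Nat.mod_eq_of_lt hi
  refine ⟨n + 1, fun i => v (Fin.ofNat (n + 1) i),
    fun i => ⟨e (Fin.ofNat (n + 1) i), (h _).1⟩, ⟨hl, fun i hi j hj hij => ?_,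
    fun i hi j hj hij => ?_, fun i _ => (h _).2.1, fun i hi => ?_, ?_⟩,
    fun i j h1 h2 h3 => hdisj _ _ ?_ ?_ ?_, ?_⟩
  · have := congrArg Fin.val (hv hij)
    rwa [hval i hi, hval j hj] at this
  · have := congrArg Fin.val (he (congrArg Subtype.val hij))
    rwa [hval i hi, hval j hj] at this
  · have := (h (Fin.ofNat (n + 1) i)).2.2
    rwa [hrot, hval i (by omega)] at this
  · have := (h (Fin.ofNat (n + 1) n)).2.2
    rw [hrot, hval n (by omega)] at this
    have h0 : Fin.ofNat (n + 1) 0 = Fin.ofNat (n + 1) (n + 1) := by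
      ext
      simp
    simp only [h0]
    exact this
  · rw [Ne, Fin.ext_iff, hval i (by omega), hval j h2]
    omega
  · rw [Ne, Fin.ext_iff, hrot, hval i (by omega), hval j h2, hval (i + 1) (by omega)]
    omega
  · rw [Ne, Fin.ext_iff, hrot, hval j (by omega), hval i (by omega)]
    rcases Nat.lt_or_ge (j + 1) (n + 1) with h4 | h4
    · rw [hval (j + 1) h4]; omega
    · have : j = n := by omega
      subst this
      simp only [Fin.ofNat, Nat.mod_self]
      omega
  · ext x
    constructor
    · rintro ⟨i, rfl⟩
      exact ⟨i, i.2, by simp⟩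
    · rintro ⟨i, hi, rfl⟩
      exact ⟨_, rfl⟩

/-- The edges `e₀ = {u, p, …}`, `f = {p, q, …}`, `e₁ = {q, u, …}` form a triangle, and all other
edges contain `u` and are disjoint from `f`. -/
structure IsTriangleSun (G : Hypergraph V) (u p q : V) (e₀ f e₁ : Set V) : Prop where
  mem₀ : e₀ ∈ G.edgeSet
  memf : f ∈ G.edgeSet
  mem₁ : e₁ ∈ G.edgeSet
  hu₀ : u ∈ e₀
  hp₀ : p ∈ e₀
  hpf : p ∈ f
  hqf : q ∈ f
  hq₁ : q ∈ e₁
  hu₁ : u ∈ e₁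
  ne₀₁ : e₀ ≠ e₁
  hpq : p ≠ q
  huf : u ∉ f
  through : ∀ e ∈ G.edgeSet, e ≠ f → u ∈ e
  disj : ∀ e ∈ G.edgeSet, e ≠ e₀ → e ≠ e₁ → e ≠ f → Disjoint e f

/-- Linearity excludes a cycle of length `2`. In a cycle of length at least `4`, each of the
disjoint pairs `e 0, e 2` and `e 1, e 3` contains an edge missing `u`, which is one too many. So the
cycle is a triangle, and linearity prevents `u` from lying on all three edges. -/
theorem exists_isTriangleSun (hlin : G.IsLinear) (huni : G.IsUnicyclic) {u : V}
    (hu : ∀ e ∈ G.edgeSet, ∀ f ∈ G.edgeSet, u ∉ e → u ∉ f → e = f) :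
    ∃ p q e₀ f e₁, G.IsTriangleSun u p q e₀ f e₁ := by
  obtain ⟨-, ⟨S, F⟩, hC, huniq⟩ := huni
  have huniq' : ∀ S' F', G.IsCycle S' F' → F' = F := fun S' F' h =>
    (Prod.ext_iff.1 (huniq (S', F') h)).2
  obtain ⟨l, v, e, h, hdisj, -⟩ := hC.exists_isClosedChain
  have hl := h.two_le
  have hne : ∀ {v e}, IsClosedChain (fun x (b : G.edgeSet) => x ∈ b.1) l v e →
      ∀ i < l, ∀ j < l, i ≠ j → (e i).1 ≠ (e j).1 := fun h i hi j hj hij h1 =>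
    hij (h.inj_block i hi j hj (Subtype.ext h1))
  have hpne : ∀ {v e}, IsClosedChain (fun x (b : G.edgeSet) => x ∈ b.1) l v e →
      ∀ i < l, ∀ j < l, i ≠ j → v i ≠ v j := fun h i hi j hj hij h1 =>
    hij (h.inj_point i hi j hj h1)
  have hl2 : l ≠ 2 := by
    rintro rfl
    exact hpne h 0 (by omega) 1 (by omega) (by omega) (hlin.eq_of_mem (e 0).2 (e 1).2
      (hne h 0 (by omega) 1 (by omega) (by omega)) (h.left 0 (by omega)) h.last
      (h.right 0 (by omega)) (h.left 1 (by omega)))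
  have hl3 : l = 3 := by
    by_contra hl3
    have h02 := hdisj 0 2 (by omega) (by omega) (by omega)
    have h13 := hdisj 1 3 (by omega) (by omega) (by omega)
    have key : ∀ i < l, ∀ j < l, i ≠ j → u ∈ (e i).1 ∨ u ∈ (e j).1 := fun i hi j hj hij => by
      by_contra hc
      push Not at hc
      exact hne h i hi j hj hij (hu _ (e i).2 _ (e j).2 hc.1 hc.2)
    rw [Set.disjoint_left] at h02 h13
    by_cases h0 : u ∈ (e 0).1 <;> by_cases h1 : u ∈ (e 1).1
    · rcases key 2 (by omega) 3 (by omega) (by omega) with h2 | h2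
      · exact h02 h0 h2
      · exact h13 h1 h2
    · rcases key 2 (by omega) 1 (by omega) (by omega) with h2 | h2
      · exact h02 h0 h2
      · exact h1 h2
    · rcases key 0 (by omega) 3 (by omega) (by omega) with h2 | h2
      · exact h0 h2
      · exact h13 h1 h2
    · rcases key 0 (by omega) 1 (by omega) (by omega) with h2 | h2
      · exact h0 h2
      · exact h1 h2
  subst hl3
  have hs : ∃ s < 3, u ∉ (e s).1 := by
    by_contra hs
    push Not at hs
    have h1 : u = v 1 := hlin.eq_of_mem (e 0).2 (e 1).2 (hne h 0 (by omega) 1 (by omega) (by omega))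
      (hs 0 (by omega)) (hs 1 (by omega)) (h.right 0 (by omega)) (h.left 1 (by omega))
    have h2 : u = v 2 := hlin.eq_of_mem (e 1).2 (e 2).2 (hne h 1 (by omega) 2 (by omega) (by omega))
      (hs 1 (by omega)) (hs 2 (by omega)) (h.right 1 (by omega)) (h.left 2 (by omega))
    exact hpne h 1 (by omega) 2 (by omega) (by omega) (h1.symm.trans h2)
  obtain ⟨s, hs, hus⟩ := hs
  have hrot : ∃ v e, IsClosedChain (fun x (b : G.edgeSet) => x ∈ b.1) 3 v e ∧ u ∉ (e 1).1 := by
    refine ⟨_, _, h.rotate (s := if s = 0 then 2 else s - 1) (by split_ifs <;> omega), ?_⟩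
    rwa [show wrap 3 ((if s = 0 then 2 else s - 1) + 1) = s by unfold wrap; split_ifs <;> omega]
  clear hdisj hus hs s h v e
  obtain ⟨v, e, h, hu1⟩ := hrot
  have hthrough : ∀ c ∈ G.edgeSet, c ≠ (e 1).1 → u ∈ c := fun c hc hce => by
    by_contra huc
    exact hce (hu c hc _ (e 1).2 huc hu1)
  have hu0 := hthrough _ (e 0).2 (hne h 0 (by omega) 1 (by omega) (by omega))
  have hu2 := hthrough _ (e 2).2 (hne h 2 (by omega) 1 (by omega) (by omega))
  have huv : v 0 = u := hlin.eq_of_mem (e 0).2 (e 2).2 (hne h 0 (by omega) 2 (by omega) (by omega))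
    (h.left 0 (by omega)) h.last hu0 hu2
  have hF := huniq' _ _ (isCycle_of_isClosedChain h fun i j h1 h2 h3 => by omega)
  refine ⟨v 1, v 2, (e 0).1, (e 1).1, (e 2).1, (e 0).2, (e 1).2, (e 2).2, hu0, h.right 0 (by omega),
    h.left 1 (by omega), h.right 1 (by omega), h.left 2 (by omega), hu2,
    hne h 0 (by omega) 2 (by omega) (by omega), hpne h 1 (by omega) 2 (by omega) (by omega), hu1,
    hthrough, fun g hg hg0 hg2 hg1 => ?_⟩
  rw [Set.disjoint_left]
  intro x hxg hxf
  have hug := hthrough g hg hg1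
  have hxu : x ≠ u := fun h => hu1 (h ▸ hxf)
  have hpu : v 1 ≠ u := fun h1 => hu1 (h1 ▸ h.left 1 (by omega))
  have hxp : x ≠ v 1 := fun h1 => hpu (hlin.eq_of_mem hg (e 0).2 hg0 (h1 ▸ hxg)
    (h.right 0 (by omega)) hug hu0)
  -- A further edge `g` through `u` meeting `f` at `x` would form a second triangle, with vertices
  -- `u`, `v 1`, `x`.
  have hc := isClosedChain_three (I := fun x (b : G.edgeSet) => x ∈ b.1) (b₀ := e 0) (b₁ := e 1)
    (b₂ := ⟨g, hg⟩) hpu.symm hxu.symm hxp.symm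
    (fun h1 => hne h 0 (by omega) 1 (by omega) (by omega) (congrArg Subtype.val h1))
    (fun h1 => hg0 (congrArg Subtype.val h1).symm) (fun h1 => hg1 (congrArg Subtype.val h1).symm)
    hu0 (h.right 0 (by omega)) (h.left 1 (by omega)) hxf hxg hug
  have hF' := huniq' _ _ (isCycle_of_isClosedChain hc fun i j h1 h2 h3 => by omega)
  have hmem : g ∈ F := by
    rw [← hF']
    exact ⟨2, by simp, rfl⟩
  rw [← hF] at hmem
  obtain ⟨i, hi, hi'⟩ := hmem
  have hi : i < 3 := hi
  interval_cases i
  · exact hg0 hi'.symm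
  · exact hg1 hi'.symm
  · exact hg2 hi'.symm

end Sun

end Hypergraph

/-! ### Isomorphism with `U_{m,3}` -/

theorem exists_fin_range_eq {α : Type*} {A : Set α} {n : ℕ} (hn : A.ncard = n)
    (hA : A.Finite) : ∃ s : Fin n → α, Set.range s = A := by
  have : Finite A := hA
  have e : A ≃ Fin n := (Finite.equivFinOfCardEq (by rw [← hn]; rfl))
  refine ⟨fun i => (e.symm i : α), ?_⟩
  ext x
  constructor
  · rintro ⟨i, rfl⟩
    exact (e.symm i).2
  · intro hx
    exact ⟨e ⟨x, hx⟩, by simp⟩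

theorem exists_fin_range_eq_of_mem {α : Type*} {A : Set α} {n : ℕ} (hn : A.ncard = n)
    (hA : A.Finite) {a : α} (ha : a ∈ A) (i : Fin n) :
    ∃ s : Fin n → α, Set.range s = A ∧ s i = a := by
  obtain ⟨s, hs⟩ := exists_fin_range_eq hn hA
  obtain ⟨j, hj⟩ : a ∈ Set.range s := hs ▸ ha
  refine ⟨s ∘ Equiv.swap i j, ?_, by simp [hj]⟩
  rw [Set.range_comp, Equiv.range_eq_univ, Set.image_univ, hs]

namespace Hypergraph

section Sun

variable {V : Type*} {G : Hypergraph V} {u p q : V} {e₀ f e₁ : Set V}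

namespace IsTriangleSun

theorem ne₀f (h : G.IsTriangleSun u p q e₀ f e₁) : e₀ ≠ f := fun h1 => h.huf (h1 ▸ h.hu₀)

theorem ne₁f (h : G.IsTriangleSun u p q e₀ f e₁) : e₁ ≠ f := fun h1 => h.huf (h1 ▸ h.hu₁)

theorem hup (h : G.IsTriangleSun u p q e₀ f e₁) : u ≠ p := fun h1 => h.huf (h1 ▸ h.hpf)

theorem huq (h : G.IsTriangleSun u p q e₀ f e₁) : u ≠ q := fun h1 => h.huf (h1 ▸ h.hqf)

theorem eq_or_eq_of_mem_p (h : G.IsTriangleSun u p q e₀ f e₁) (hlin : G.IsLinear) {e : Set V}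
    (he : e ∈ G.edgeSet) (hp : p ∈ e) : e = e₀ ∨ e = f := by
  by_contra hc
  push Not at hc
  exact h.hup (hlin.eq_of_mem he h.mem₀ hc.1 (h.through e he hc.2) h.hu₀ hp h.hp₀)

theorem eq_or_eq_of_mem_q (h : G.IsTriangleSun u p q e₀ f e₁) (hlin : G.IsLinear) {e : Set V}
    (he : e ∈ G.edgeSet) (hq : q ∈ e) : e = e₁ ∨ e = f := by
  by_contra hc
  push Not at hc
  exact h.huq (hlin.eq_of_mem he h.mem₁ hc.1 (h.through e he hc.2) h.hu₁ hq h.hq₁)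

theorem eq_of_mem_f (h : G.IsTriangleSun u p q e₀ f e₁) (hlin : G.IsLinear) {e : Set V}
    (he : e ∈ G.edgeSet) (hef : e ≠ f) {x : V} (hx : x ∈ e) (hxf : x ∈ f) : x = p ∨ x = q := by
  by_cases h0 : e = e₀
  · subst h0
    exact Or.inl (hlin.eq_of_mem he h.memf hef hx hxf h.hp₀ h.hpf)
  · by_cases h1 : e = e₁
    · subst h1
      exact Or.inr (hlin.eq_of_mem he h.memf hef hx hxf h.hq₁ h.hqf)
    · exact absurd hxf (Set.disjoint_left.1 (h.disj e he h0 h1 hef) hx)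

theorem edge_unique (h : G.IsTriangleSun u p q e₀ f e₁) (hlin : G.IsLinear) {x : V}
    (hxu : x ≠ u) (hxp : x ≠ p) (hxq : x ≠ q) {e e' : Set V} (he : e ∈ G.edgeSet)
    (he' : e' ∈ G.edgeSet) (hx : x ∈ e) (hx' : x ∈ e') : e = e' := by
  by_contra hne
  by_cases hef : e = f
  · subst hef
    rcases h.eq_of_mem_f hlin he' (Ne.symm hne) hx' hx with h1 | h1
    exacts [hxp h1, hxq h1]
  · by_cases hef' : e' = f
    · subst hef'
      rcases h.eq_of_mem_f hlin he hne hx hx' with h1 | h1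
      exacts [hxp h1, hxq h1]
    · exact hxu (hlin.eq_of_mem he he' hne hx hx' (h.through e he hef) (h.through e' he' hef'))

end IsTriangleSun

theorem isIsomorphic_of_bijective {W : Type*} {H : Hypergraph W} {ψ : W → V}
    (hψ : Function.Bijective ψ) (hV : G.vertexSet = Set.univ) (hW : H.vertexSet = Set.univ)
    (h1 : ∀ e ∈ H.edgeSet, ψ '' e ∈ G.edgeSet)
    (h2 : ∀ e ∈ G.edgeSet, ∃ e' ∈ H.edgeSet, ψ '' e' = e) : G.IsIsomorphic H := by
  set φ := Equiv.ofBijective ψ hψ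
  have hφ : ∀ e : Set W, φ.symm '' (ψ '' e) = e := fun e => by
    change φ.symm '' (φ '' e) = e
    exact φ.symm_image_image e
  refine ⟨φ.symm, Hypergraph.ext ?_ ?_⟩
  · rw [image_vertexSet, hV, hW, Set.image_univ, φ.symm.range_eq_univ]
  · ext e
    rw [mem_edgeSet_image]
    constructor
    · rintro ⟨e', he', rfl⟩
      obtain ⟨d, hd, rfl⟩ := h2 e' he'
      rwa [hφ]
    · intro he
      exact ⟨_, h1 e he, hφ e⟩

variable [Fintype V] {k m : ℕ}

theorem sum_degree_eq_mul (hG : G.IsUniform k) : ∑ x, G.degree x = G.edgeSet.ncard * k := by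
  simp only [degree_eq_card_edgesAt, Finset.card_eq_sum_ones]
  rw [← sum_sum_verts_comm G fun _ _ => 1, ← card_edges, ← smul_eq_mul, ← Finset.sum_const]
  refine Finset.sum_congr rfl fun e he => ?_
  rw [← Finset.card_eq_sum_ones, card_verts, hG e (by simpa using he)]

/-- Enumerating each edge without one attaching vertex gives a map from the model that matches edges
with edges. It is onto because every vertex lies on an edge, so injectivity reduces to a count of
vertices. -/
theorem IsTriangleSun.isIsomorphic (h : G.IsTriangleSun u p q e₀ f e₁) (hk : 3 ≤ k) (hm : 3 ≤ m)
    (hV : G.vertexSet = Set.univ) (hG : G.IsUniform k) (hlin : G.IsLinear)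
    (huni : G.IsUnicyclic) (hsize : G.edgeSet.ncard = m) :
    G.IsIsomorphic (unicyclicU3 k m hk) := by
  classical
  have hk1 : 0 < k - 1 := by omega
  set E : Fin 3 → Set V := ![e₀, f, e₁] with hE
  set w : Fin 3 → V := ![u, p, q] with hw
  have hEG : ∀ i, E i ∈ G.edgeSet := by
    intro i
    fin_cases i
    exacts [h.mem₀, h.memf, h.mem₁]
  have hwE : ∀ i, w i ∈ E i := by
    intro i
    fin_cases i
    exacts [h.hu₀, h.hpf, h.hq₁]
  have hwE' : ∀ i, w (finRotate 3 i) ∈ E i := by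
    intro i
    fin_cases i
    exacts [h.hp₀, h.hqf, h.hu₁]
  have hww : ∀ i, w i ≠ w (finRotate 3 i) := by
    intro i
    fin_cases i
    exacts [h.hup, h.hpq, h.huq.symm]
  have hs : ∀ i, ∃ s : Fin (k - 1) → V, Set.range s = E i \ {w (finRotate 3 i)} ∧
      s ⟨0, hk1⟩ = w i := fun i => by
    refine exists_fin_range_eq_of_mem (A := E i \ {w (finRotate 3 i)}) ?_ (Set.toFinite _) ⟨hwE i, hww i⟩ _
    rw [Set.ncard_sdiff_singleton_of_mem (hwE' i), hG _ (hEG i)]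
  choose s hsr hs0 using hs
  have hP : (G.edgeSet \ {e₀, f, e₁}).ncard = m - 3 := by
    have h3 : ({e₀, f, e₁} : Set (Set V)).ncard = 3 :=
      Set.ncard_eq_three.2 ⟨e₀, f, e₁, h.ne₀f, h.ne₀₁, h.ne₁f.symm, rfl⟩
    rw [Set.ncard_sdiff, hsize, h3]
    rintro e (rfl | rfl | rfl)
    exacts [h.mem₀, h.memf, h.mem₁]
  obtain ⟨τ, hτ⟩ := exists_fin_range_eq hP (Set.toFinite _)
  have hτmem : ∀ j, τ j ∈ G.edgeSet \ {e₀, f, e₁} := fun j => hτ ▸ ⟨j, rfl⟩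
  have huτ : ∀ j, u ∈ τ j := fun j => h.through _ (hτmem j).1 fun h1 =>
    (hτmem j).2 (by simp [h1])
  have hs' : ∀ j, ∃ s : Fin (k - 1) → V, Set.range s = τ j \ {u} := fun j => by
    refine exists_fin_range_eq ?_ (Set.toFinite _)
    rw [Set.ncard_sdiff_singleton_of_mem (huτ j), hG _ (hτmem j).1]
  choose s' hs' using hs'
  set ψ : (Fin 3 × Fin (k - 1)) ⊕ (Fin (m - 3) × Fin (k - 1)) → V :=
    Sum.elim (fun x => s x.1 x.2) (fun x => s' x.1 x.2) with hψ
  have hcyc : ∀ i : Fin 3, ψ '' (Sum.inl '' {x : Fin 3 × Fin (k - 1) |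
      x.1 = i ∨ (x.1 = finRotate 3 i ∧ (x.2 : ℕ) = 0)}) = E i := by
    intro i
    ext x
    constructor
    · rintro ⟨-, ⟨⟨a, b⟩, hab, rfl⟩, rfl⟩
      rcases hab with hab | ⟨hab, hb⟩
      · simp only at hab
        subst hab
        have : s a b ∈ E a \ {w (finRotate 3 a)} := hsr a ▸ ⟨b, rfl⟩
        exact this.1
      · simp only at hab hb
        have hb : b = ⟨0, hk1⟩ := Fin.ext hb
        subst hab hb
        change s _ _ ∈ _
        rw [hs0]
        exact hwE' i
    · intro hx
      by_cases hxw : x = w (finRotate 3 i)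
      · exact ⟨_, ⟨(finRotate 3 i, ⟨0, hk1⟩), Or.inr ⟨rfl, rfl⟩, rfl⟩, by
          change s _ _ = _
          rw [hs0, hxw]⟩
      · obtain ⟨b, rfl⟩ : x ∈ Set.range (s i) := hsr i ▸ ⟨hx, hxw⟩
        exact ⟨_, ⟨(i, b), Or.inl rfl, rfl⟩, rfl⟩
  have hpend : ∀ j : Fin (m - 3), ψ '' (insert (Sum.inl (0, ⟨0, hk1⟩))
      (Set.range fun i => Sum.inr (j, i))) = τ j := by
    intro j
    have h0 : ψ (Sum.inl (0, ⟨0, hk1⟩)) = u := hs0 0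
    rw [Set.image_insert_eq, h0, ← Set.range_comp]
    change insert u (Set.range (s' j)) = τ j
    rw [hs', Set.insert_sdiff_singleton, Set.insert_eq_of_mem (huτ j)]
  have hedge : ∀ e ∈ G.edgeSet, ∃ e' ∈ (unicyclicU3 k m hk).edgeSet, ψ '' e' = e := by
    intro e he
    by_cases hE' : ∃ i, E i = e
    · obtain ⟨i, rfl⟩ := hE'
      exact ⟨_, Or.inl ⟨_, ⟨i, rfl⟩, rfl⟩, hcyc i⟩
    · push Not at hE'
      obtain ⟨j, rfl⟩ : e ∈ Set.range τ := by
        rw [hτ]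
        refine ⟨he, ?_⟩
        rintro (rfl | rfl | rfl)
        exacts [hE' 0 rfl, hE' 1 rfl, hE' 2 rfl]
      exact ⟨_, Or.inr ⟨j, rfl⟩, hpend j⟩
  have hsurj : Function.Surjective ψ := by
    intro x
    have hx := huni.one_le_degree hV x
    rw [degree_eq_card_edgesAt, Nat.succ_le_iff, Finset.card_pos] at hx
    obtain ⟨e, he⟩ := hx
    rw [mem_edgesAt] at he
    obtain ⟨e', -, rfl⟩ := hedge e he.1
    obtain ⟨y, -, hy⟩ := he.2
    exact ⟨y, hy⟩
  refine isIsomorphic_of_bijective (ψ := ψ) ?_ hV ?_ ?_ hedge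
  · rw [Fintype.bijective_iff_surjective_and_card]
    refine ⟨hsurj, le_antisymm ?_ (Fintype.card_le_of_surjective _ hsurj)⟩
    -- `|V| = ∑ d - ∑ (d - 1) ≥ m * k - m`, and `m * (k - 1)` is the number of vertices of the
    -- model.
    have h1 := huni.sum_degree_sub_one_le hlin hV
    have h2 := sum_degree_eq_mul hG
    have h3 : ∑ x, (G.degree x - 1) + Fintype.card V = ∑ x, G.degree x := by
      rw [← Finset.card_univ, Finset.card_eq_sum_ones, ← Finset.sum_add_distrib]
      exact Finset.sum_congr rfl fun x _ => Nat.sub_add_cancel (huni.one_le_degree hV x)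
    simp only [Fintype.card_sum, Fintype.card_prod, Fintype.card_fin]
    rw [← add_mul, show 3 + (m - 3) = m by omega, Nat.mul_sub, mul_one]
    rw [hsize] at h1 h2
    omega
  · ext x
    simp only [Set.mem_univ, iff_true]
    rcases x with x | x
    · exact Or.inl ⟨x, trivial, rfl⟩
    · exact Or.inr ⟨x, rfl⟩
  · rintro e (⟨-, ⟨i, rfl⟩, rfl⟩ | ⟨j, rfl⟩)
    · simp only
      rw [hcyc]
      exact hEG i
    · simp only
      rw [hpend]
      exact (hτmem j).1

/-- A hypergraph isomorphic to `U_{m,3}` has a vertex contained in all edges but one. -/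
theorem exists_vertex_of_isIsomorphic {V : Type*} {G : Hypergraph V} {k m : ℕ} (hk : 3 ≤ k)
    (h : G.IsIsomorphic (unicyclicU3 k m hk)) :
    ∃ u, ∀ e ∈ G.edgeSet, ∀ f ∈ G.edgeSet, u ∉ e → u ∉ f → e = f := by
  obtain ⟨φ, hφ⟩ := h
  have hk1 : 0 < k - 1 := by omega
  refine ⟨φ.symm (Sum.inl (0, ⟨0, hk1⟩)), ?_⟩
  have key : ∀ e ∈ G.edgeSet, φ.symm (Sum.inl (0, ⟨0, hk1⟩)) ∉ e →
      φ '' e = Sum.inl '' {x : Fin 3 × Fin (k - 1) |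
        x.1 = 1 ∨ (x.1 = finRotate 3 1 ∧ (x.2 : ℕ) = 0)} := by
    intro e he hu
    have hu' : Sum.inl (0, ⟨0, hk1⟩) ∉ φ '' e := by
      rintro ⟨x, hx, hx'⟩
      exact hu (by rwa [← hx', Equiv.symm_apply_apply])
    have he' : φ '' e ∈ (unicyclicU3 k m hk).edgeSet := by
      rw [← hφ]
      exact image_mem_edgeSet_image he
    rcases he' with ⟨-, ⟨i, rfl⟩, hi⟩ | ⟨j, hj⟩
    · simp only at hi
      rw [← hi] at hu' ⊢
      fin_cases i
      · exact absurd ⟨_, Or.inl rfl, rfl⟩ hu'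
      · rfl
      · exact absurd ⟨_, Or.inr ⟨rfl, rfl⟩, rfl⟩ hu'
    · rw [← hj] at hu'
      exact absurd (Or.inl rfl) hu'
  intro e he f hf hue huf
  exact φ.injective.image_injective ((key e he hue).trans (key f hf huf).symm)

end Sun

end Hypergraph

/-! ### The exact spectral radius of the extremal hypergraph -/

namespace Hypergraph

variable {V : Type*} [Fintype V] {G : Hypergraph V} {k m : ℕ}

theorem prod_verts_of_pair {e : Set V} (he : e.ncard = k) {x y : V} (hx : x ∈ e) (hy : y ∈ e)
    (hxy : x ≠ y) (g : V → ℝ) {c : ℝ} (hg : ∀ z ∈ e, z ≠ x → z ≠ y → g z = c) :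
    ∏ z ∈ verts e, g z = g x * g y * c ^ (k - 2) := by
  classical
  have hx' : x ∈ verts e := by simpa using hx
  have hy' : y ∈ (verts e).erase x := by simpa using ⟨hxy.symm, hy⟩
  rw [← Finset.mul_prod_erase _ _ hx', ← Finset.mul_prod_erase _ _ hy', mul_assoc,
    Finset.prod_eq_pow_card (b := c), Finset.card_erase_of_mem hy', Finset.card_erase_of_mem hx',
    card_verts, he]
  · rfl
  · intro z hz
    simp only [Finset.mem_erase, mem_verts] at hz
    exact hg z hz.2.2 hz.2.1 hz.1

theorem prod_verts_of_single {e : Set V} (he : e.ncard = k) {x : V} (hx : x ∈ e)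
    (g : V → ℝ) {c : ℝ} (hg : ∀ z ∈ e, z ≠ x → g z = c) :
    ∏ z ∈ verts e, g z = g x * c ^ (k - 1) := by
  classical
  have hx' : x ∈ verts e := by simpa using hx
  rw [← Finset.mul_prod_erase _ _ hx', Finset.prod_eq_pow_card (b := c),
    Finset.card_erase_of_mem hx', card_verts, he]
  intro z hz
  simp only [Finset.mem_erase, mem_verts] at hz
  exact hg z hz.2 hz.1

theorem abcWeight_of_pair {e : Set V} (he : e.ncard = k) {x y : V} (hx : x ∈ e) (hy : y ∈ e)
    (hxy : x ≠ y) (hd : ∀ z ∈ e, z ≠ x → z ≠ y → G.degree z = 1) :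
    G.abcWeight k e = ((G.degree x - 1 : ℝ) + (G.degree y - 1)) / (G.degree x * G.degree y) := by
  rw [abcWeight_eq G k he, prod_verts_of_pair he hx hy hxy (fun z => (G.degree z : ℝ)) (c := 1)
    (fun z hz h1 h2 => by rw [hd z hz h1 h2, Nat.cast_one]), one_pow, mul_one,
    Finset.sum_eq_add_of_mem x y (by simpa using hx) (by simpa using hy) hxy]
  intro z hz hz'
  rw [hd z (by simpa using hz) hz'.1 hz'.2, Nat.cast_one, sub_self]

theorem abcWeight_of_single {e : Set V} (he : e.ncard = k) {x : V} (hx : x ∈ e)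
    (hd : ∀ z ∈ e, z ≠ x → G.degree z = 1) :
    G.abcWeight k e = (G.degree x - 1 : ℝ) / G.degree x := by
  rw [abcWeight_eq G k he, prod_verts_of_single he hx (fun z => (G.degree z : ℝ)) (c := 1)
    (fun z hz h1 => by rw [hd z hz h1, Nat.cast_one]), one_pow, mul_one,
    Finset.sum_eq_single_of_mem x (by simpa using hx)]
  intro z hz hz'
  rw [hd z (by simpa using hz) hz', Nat.cast_one, sub_self]

variable {u p q : V} {e₀ f e₁ : Set V}

namespace IsTriangleSun

theorem edgesAt_u [DecidableEq (Set V)] (h : G.IsTriangleSun u p q e₀ f e₁) :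
    G.edgesAt u = insert e₀ (insert e₁ (((G.edges.erase f).erase e₀).erase e₁)) := by
  ext e
  simp only [mem_edgesAt, Finset.mem_insert, Finset.mem_erase, mem_edges]
  constructor
  · rintro ⟨he, hu⟩
    have hef : e ≠ f := fun h1 => h.huf (h1 ▸ hu)
    tauto
  · rintro (rfl | rfl | ⟨-, -, hef, he⟩)
    exacts [⟨h.mem₀, h.hu₀⟩, ⟨h.mem₁, h.hu₁⟩, ⟨he, h.through e he hef⟩]

theorem edgesAt_p [DecidableEq (Set V)] (h : G.IsTriangleSun u p q e₀ f e₁) (hlin : G.IsLinear) :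
    G.edgesAt p = {e₀, f} := by
  ext e
  simp only [mem_edgesAt, Finset.mem_insert, Finset.mem_singleton]
  constructor
  · rintro ⟨he, hp⟩
    exact h.eq_or_eq_of_mem_p hlin he hp
  · rintro (rfl | rfl)
    exacts [⟨h.mem₀, h.hp₀⟩, ⟨h.memf, h.hpf⟩]

theorem edgesAt_q [DecidableEq (Set V)] (h : G.IsTriangleSun u p q e₀ f e₁) (hlin : G.IsLinear) :
    G.edgesAt q = {e₁, f} := by
  ext e
  simp only [mem_edgesAt, Finset.mem_insert, Finset.mem_singleton]
  constructor
  · rintro ⟨he, hq⟩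
    exact h.eq_or_eq_of_mem_q hlin he hq
  · rintro (rfl | rfl)
    exacts [⟨h.mem₁, h.hq₁⟩, ⟨h.memf, h.hqf⟩]

theorem edgesAt_of_ne (h : G.IsTriangleSun u p q e₀ f e₁) (hlin : G.IsLinear) {x : V}
    (hxu : x ≠ u) (hxp : x ≠ p) (hxq : x ≠ q) {e : Set V} (he : e ∈ G.edgeSet) (hx : x ∈ e) :
    G.edgesAt x = {e} := by
  ext e'
  simp only [mem_edgesAt, Finset.mem_singleton]
  constructor
  · rintro ⟨he', hx'⟩
    exact h.edge_unique hlin hxu hxp hxq he' he hx' hx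
  · rintro rfl
    exact ⟨he, hx⟩

theorem card_rest [DecidableEq (Set V)] (h : G.IsTriangleSun u p q e₀ f e₁)
    (hsize : G.edgeSet.ncard = m) :
    (((G.edges.erase f).erase e₀).erase e₁).card = m - 3 := by
  have h1 := h.memf
  have h2 := h.mem₀
  have h3 := h.mem₁
  rw [Finset.card_erase_of_mem, Finset.card_erase_of_mem, Finset.card_erase_of_mem, card_edges,
    hsize, Nat.sub_sub, Nat.sub_sub]
  · simpa using h1
  · simpa using ⟨h.ne₀f, h2⟩
  · simpa using ⟨h.ne₀₁.symm, h.ne₁f, h3⟩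

theorem degree_u (h : G.IsTriangleSun u p q e₀ f e₁) (hm : 3 ≤ m)
    (hsize : G.edgeSet.ncard = m) : (G.degree u : ℝ) = m - 1 := by
  classical
  rw [degree_eq_card_edgesAt, h.edgesAt_u, Finset.card_insert_of_notMem,
    Finset.card_insert_of_notMem (by simp), h.card_rest hsize, show m - 3 + 1 + 1 = m - 1 by omega,
    Nat.cast_sub (by omega), Nat.cast_one]
  simp [h.ne₀₁]

theorem degree_p (h : G.IsTriangleSun u p q e₀ f e₁) (hlin : G.IsLinear) : G.degree p = 2 := by
  classical
  rw [degree_eq_card_edgesAt, h.edgesAt_p hlin, Finset.card_pair h.ne₀f]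

theorem degree_q (h : G.IsTriangleSun u p q e₀ f e₁) (hlin : G.IsLinear) : G.degree q = 2 := by
  classical
  rw [degree_eq_card_edgesAt, h.edgesAt_q hlin, Finset.card_pair h.ne₁f]

theorem abcSpectralRadius_eq (h : G.IsTriangleSun u p q e₀ f e₁) (hk : 3 ≤ k) (hm : 3 ≤ m)
    (hG : G.IsUniform k) (hlin : G.IsLinear) (hdeg : ∀ x, 1 ≤ G.degree x)
    (hsize : G.edgeSet.ncard = m) {t : ℝ} (ht : √2 / 2 < t)
    (hroot : t ^ 3 - √2 / 2 * t ^ 2 - ((m : ℝ) ^ 2 - 4 * m + 5) / ((m : ℝ) - 1) * t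
      + √2 * ((m : ℝ) ^ 2 - 5 * m + 6) / (2 * ((m : ℝ) - 1)) = 0) :
    G.abcSpectralRadius k = (t ^ 2) ^ ((1 : ℝ) / k) := by
  classical
  have : Nonempty V := ⟨u⟩
  have hm' : (3 : ℝ) ≤ m := by exact_mod_cast hm
  set s : ℝ := √2 / 2 with hs
  have hs2 : s ^ 2 = 1 / 2 := by rw [hs, div_pow, Real.sq_sqrt (by norm_num)]; norm_num
  have hs0 : 0 < s := by positivity
  have ht0 : 0 < t := hs0.trans ht
  have hts : 0 < t - s := sub_pos.2 ht
  have hm1 : (0 : ℝ) < m - 1 := by linarith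
  have hm2 : (0 : ℝ) < m - 2 := by linarith
  have h2s : √2 = 2 * s := by rw [hs]; ring
  rw [h2s] at hroot
  -- Normalise `X u = 1` and let `y = X p = X q`. On a vertex of degree one, `X` is the label of its
  -- edge: `c₁` on `e₀` and `e₁`, `c₂` on `f`, `β` on the pendant edges. The values solve the edge
  -- equations `e3`, `e4`, `e5` and the equation `e2` at `p` and `q`. The equation `e1` at `u` is
  -- what remains, and it is the cubic.
  obtain ⟨c₁, hc₁⟩ : ∃ c₁, c₁ = 1 / (2 * t * (t - s)) := ⟨_, rfl⟩
  obtain ⟨y, hy⟩ : ∃ y, y = 1 / (2 * (t - s) ^ 2) := ⟨_, rfl⟩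
  obtain ⟨c₂, hc₂⟩ : ∃ c₂, c₂ = s * y / t := ⟨_, rfl⟩
  obtain ⟨β, hβ⟩ : ∃ β, β = ((m : ℝ) - 2) / (((m : ℝ) - 1) * t ^ 2) := ⟨_, rfl⟩
  have hc₁0 : 0 < c₁ := by rw [hc₁]; positivity
  have hy0 : 0 < y := by rw [hy]; positivity
  have hc₂0 : 0 < c₂ := by rw [hc₂]; positivity
  have hβ0 : 0 < β := by rw [hβ]; positivity
  have e1 : 2 * c₁ + (m - 3) * β = 1 := by
    rw [hc₁, hβ]
    field_simp at hroot ⊢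
    linear_combination -hroot
  have e2 : c₁ + c₂ = y := by
    rw [hc₂, hy, hc₁]
    field_simp
    ring
  have e3 : 1 / 2 * y = t ^ 2 * c₁ ^ 2 := by
    rw [hy, hc₁]
    field_simp
  have e4 : 1 / 2 * y ^ 2 = t ^ 2 * c₂ ^ 2 := by
    rw [hc₂]
    field_simp
    rw [hs2]
    ring
  have e5 : ((m : ℝ) - 2) / (m - 1) = t ^ 2 * β := by
    rw [hβ]
    field_simp
  obtain ⟨c, hc⟩ : ∃ c : Set V → ℝ, c = fun e => if e = f then c₂ else
    if e = e₀ ∨ e = e₁ then c₁ else β := ⟨_, rfl⟩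
  have hcpos : ∀ e, 0 < c e := fun e => by
    rw [hc]
    simp only
    split_ifs <;> assumption
  have hcf : c f = c₂ := by simp [hc]
  have hc0 : c e₀ = c₁ := by simp [hc, h.ne₀f]
  have hc1 : c e₁ = c₁ := by simp [hc, h.ne₁f]
  have hcr : ∀ e, e ≠ f → e ≠ e₀ → e ≠ e₁ → c e = β := fun e h1 h2 h3 => by simp [hc, h1, h2, h3]
  obtain ⟨X, hX⟩ : ∃ X : V → ℝ, X = fun x => ∑ e ∈ G.edgesAt x, c e := ⟨_, rfl⟩
  have hXu : X u = 1 := by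
    rw [hX]
    simp only
    rw [h.edgesAt_u, Finset.sum_insert (by simp [h.ne₀₁]), Finset.sum_insert (by simp), hc0, hc1,
      Finset.sum_congr rfl (g := fun _ => β), Finset.sum_const, h.card_rest hsize, nsmul_eq_mul,
      Nat.cast_sub hm, ← e1]
    · push_cast; ring
    · intro e he
      simp only [Finset.mem_erase] at he
      exact hcr e he.2.2.1 he.2.1 he.1
  have hXp : X p = y := by
    rw [hX]
    simp only
    rw [h.edgesAt_p hlin, Finset.sum_pair h.ne₀f, hc0, hcf, e2]
  have hXq : X q = y := by
    rw [hX]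
    simp only
    rw [h.edgesAt_q hlin, Finset.sum_pair h.ne₁f, hc1, hcf, e2]
  have hXr : ∀ e ∈ G.edgeSet, ∀ x ∈ e, x ≠ u → x ≠ p → x ≠ q → X x = c e :=
    fun e he x hx h1 h2 h3 => by
      rw [hX]
      simp only
      rw [h.edgesAt_of_ne hlin h1 h2 h3 he hx, Finset.sum_singleton]
  have hdr : ∀ e ∈ G.edgeSet, ∀ x ∈ e, x ≠ u → x ≠ p → x ≠ q → G.degree x = 1 :=
    fun e he x hx h1 h2 h3 => by
      rw [degree_eq_card_edgesAt, h.edgesAt_of_ne hlin h1 h2 h3 he hx, Finset.card_singleton]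
  have hdu := h.degree_u hm hsize
  have hdp := h.degree_p hlin
  have hdq := h.degree_q hlin
  have hq0 : q ∉ e₀ := fun h1 => by
    rcases h.eq_or_eq_of_mem_q hlin h.mem₀ h1 with h2 | h2
    exacts [h.ne₀₁ h2, h.ne₀f h2]
  have hp1 : p ∉ e₁ := fun h1 => by
    rcases h.eq_or_eq_of_mem_p hlin h.mem₁ h1 with h2 | h2
    exacts [h.ne₀₁ h2.symm, h.ne₁f h2]
  have hsplit : ∀ x : ℝ, x ^ k = x ^ 2 * x ^ (k - 2) := fun x => by
    rw [← pow_add]; congr 1; omega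
  refine abcSpectralRadius_eq_of_labeling hk hG (by positivity) X c (fun x => ?_)
    (fun e _ => hcpos e) (fun x => by rw [hX]) fun e he => ?_
  · rw [hX]
    refine Finset.sum_pos (fun e _ => hcpos e) ?_
    rw [← Finset.card_pos, ← degree_eq_card_edgesAt]
    exact hdeg x
  have hhalf : ((m : ℝ) - 1 - 1 + (2 - 1)) / ((m - 1) * 2) = 1 / 2 := by
    field_simp
    ring
  by_cases hef : e = f
  · subst hef
    have h1 : ∀ z ∈ e, z ≠ p → z ≠ q → z ≠ u := fun z hz _ _ hzu => h.huf (hzu ▸ hz)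
    rw [abcWeight_of_pair (hG e he) h.hpf h.hqf h.hpq
        (fun z hz hzp hzq => hdr e he z hz (h1 z hz hzp hzq) hzp hzq), hdp, hdq,
      prod_verts_of_pair (hG e he) h.hpf h.hqf h.hpq X
        (fun z hz hzp hzq => hXr e he z hz (h1 z hz hzp hzq) hzp hzq), hXp, hXq, hcf, hsplit c₂]
    push_cast
    linear_combination c₂ ^ (k - 2) * e4
  by_cases he0 : e = e₀
  · subst he0
    have h1 : ∀ z ∈ e, z ≠ u → z ≠ p → z ≠ q := fun z hz _ _ hzq => hq0 (hzq ▸ hz)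
    rw [abcWeight_of_pair (hG e he) h.hu₀ h.hp₀ h.hup
        (fun z hz hzu hzp => hdr e he z hz hzu hzp (h1 z hz hzu hzp)), hdu, hdp,
      prod_verts_of_pair (hG e he) h.hu₀ h.hp₀ h.hup X
        (fun z hz hzu hzp => hXr e he z hz hzu hzp (h1 z hz hzu hzp)), hXu, hXp, hc0, hsplit c₁,
      Nat.cast_ofNat, hhalf]
    linear_combination c₁ ^ (k - 2) * e3
  by_cases he1 : e = e₁
  · subst he1
    have h1 : ∀ z ∈ e, z ≠ u → z ≠ q → z ≠ p := fun z hz _ _ hzp => hp1 (hzp ▸ hz)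
    rw [abcWeight_of_pair (hG e he) h.hu₁ h.hq₁ h.huq
        (fun z hz hzu hzq => hdr e he z hz hzu (h1 z hz hzu hzq) hzq), hdu, hdq,
      prod_verts_of_pair (hG e he) h.hu₁ h.hq₁ h.huq X
        (fun z hz hzu hzq => hXr e he z hz hzu (h1 z hz hzu hzq) hzq), hXu, hXq, hc1, hsplit c₁,
      Nat.cast_ofNat, hhalf]
    linear_combination c₁ ^ (k - 2) * e3
  · have hue := h.through e he hef
    have hdis := Set.disjoint_left.1 (h.disj e he he0 he1 hef)
    have h1 : ∀ z ∈ e, z ≠ p ∧ z ≠ q := fun z hz =>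
      ⟨fun h2 => hdis hz (h2 ▸ h.hpf), fun h2 => hdis hz (h2 ▸ h.hqf)⟩
    rw [abcWeight_of_single (hG e he) hue
        (fun z hz hzu => hdr e he z hz hzu (h1 z hz).1 (h1 z hz).2), hdu,
      prod_verts_of_single (hG e he) hue X
        (fun z hz hzu => hXr e he z hz hzu (h1 z hz).1 (h1 z hz).2), hXu, hcr e hef he0 he1,
      show (m : ℝ) - 1 - 1 = m - 2 by ring, e5, show k = k - 1 + 1 by omega, pow_succ]
    simp only [Nat.add_sub_cancel]
    ring

end IsTriangleSun

end Hypergraph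

/-! ### The largest root of the cubic -/

section Cubic

/-- The set of real roots of the cubic attached to `U_{m,3}`. -/
abbrev cubicRoots (m : ℕ) : Set ℝ :=
  {t : ℝ | t ^ 3 - √2 / 2 * t ^ 2
    - ((m : ℝ) ^ 2 - 4 * m + 5) / ((m : ℝ) - 1) * t
    + √2 * ((m : ℝ) ^ 2 - 5 * m + 6) / (2 * ((m : ℝ) - 1)) = 0}

/-- In this form the value at `√2 / 2` is visibly `-√2 / 2`, and signs at other points reduce to the
size of `t ^ 2 - C`, where `C = (m² - 5m + 6) / (m - 1)`. -/
theorem cubic_eq {m : ℕ} (hm : 3 ≤ m) (t : ℝ) : t ^ 3 - √2 / 2 * t ^ 2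
    - ((m : ℝ) ^ 2 - 4 * m + 5) / ((m : ℝ) - 1) * t
    + √2 * ((m : ℝ) ^ 2 - 5 * m + 6) / (2 * ((m : ℝ) - 1)) =
    (t - √2 / 2) * (t ^ 2 - ((m : ℝ) ^ 2 - 5 * m + 6) / (m - 1)) - t := by
  have hm' : (3 : ℝ) ≤ m := by exact_mod_cast hm
  have hm1 : (m : ℝ) - 1 ≠ 0 := by linarith
  field_simp
  ring

theorem sqrt_two_div_two_lt_one : √2 / 2 < 1 := by
  have : √2 < 2 := by rw [Real.sqrt_lt' two_pos]; norm_num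
  linarith

theorem cubic_pos {m : ℕ} (hm : 3 ≤ m) {t : ℝ} (ht : ((m : ℝ) ^ 2 - 5 * m + 6) / (m - 1) + 2 ≤ t) :
    0 < (t - √2 / 2) * (t ^ 2 - ((m : ℝ) ^ 2 - 5 * m + 6) / (m - 1)) - t := by
  have hm' : (3 : ℝ) ≤ m := by exact_mod_cast hm
  have hC : 0 ≤ ((m : ℝ) ^ 2 - 5 * m + 6) / (m - 1) := div_nonneg (by nlinarith) (by linarith)
  have hs := sqrt_two_div_two_lt_one
  set C := ((m : ℝ) ^ 2 - 5 * m + 6) / (m - 1)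
  have h1 : t < t ^ 2 - C := by nlinarith
  nlinarith

theorem exists_isGreatest_cubicRoots {m : ℕ} (hm : 3 ≤ m) : ∃ a, IsGreatest (cubicRoots m) a := by
  have hne : (cubicRoots m).Nonempty := by
    have hcont : Continuous fun t : ℝ =>
      (t - √2 / 2) * (t ^ 2 - ((m : ℝ) ^ 2 - 5 * m + 6) / (m - 1)) - t := by fun_prop
    have hm' : (3 : ℝ) ≤ m := by exact_mod_cast hm
    have hC : 0 ≤ ((m : ℝ) ^ 2 - 5 * m + 6) / (m - 1) := div_nonneg (by nlinarith) (by linarith)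
    have hs : 0 < √2 / 2 := by positivity
    obtain ⟨t, -, ht⟩ := intermediate_value_Icc
      (by linarith [sqrt_two_div_two_lt_one] :
        √2 / 2 ≤ ((m : ℝ) ^ 2 - 5 * m + 6) / (m - 1) + 2) hcont.continuousOn
      ⟨(by simpa using hs.le : _ ≤ (0 : ℝ)), (cubic_pos hm le_rfl).le⟩
    refine ⟨t, ?_⟩
    rw [Set.mem_ofPred_eq, cubic_eq hm]
    exact ht
  have hbdd : BddAbove (cubicRoots m) := by
    refine ⟨((m : ℝ) ^ 2 - 5 * m + 6) / (m - 1) + 2, fun t ht => ?_⟩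
    rw [Set.mem_ofPred_eq, cubic_eq hm] at ht
    by_contra hlt
    exact (cubic_pos hm (not_le.1 hlt).le).ne' ht
  have hclosed : IsClosed (cubicRoots m) := isClosed_eq (by fun_prop) continuous_const
  exact ⟨_, hclosed.csSup_mem hne hbdd, fun t ht => le_csSup hbdd ht⟩

/-- The largest root of the cubic exceeds every point at which the cubic is negative. -/
theorem lt_of_cubic_neg {m : ℕ} (hm : 3 ≤ m) {a x : ℝ} (ha : IsGreatest (cubicRoots m) a)
    (hx : (x - √2 / 2) * (x ^ 2 - ((m : ℝ) ^ 2 - 5 * m + 6) / (m - 1)) - x < 0) : x < a := by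
  have hcont : Continuous fun t : ℝ =>
    (t - √2 / 2) * (t ^ 2 - ((m : ℝ) ^ 2 - 5 * m + 6) / (m - 1)) - t := by fun_prop
  have hxC : x ≤ ((m : ℝ) ^ 2 - 5 * m + 6) / (m - 1) + 2 := by
    by_contra hlt
    exact (cubic_pos hm (not_le.1 hlt).le).not_gt hx
  obtain ⟨t, ht, ht0⟩ := intermediate_value_Icc hxC hcont.continuousOn
    ⟨hx.le, (cubic_pos hm le_rfl).le⟩
  have hta : t ≤ a := ha.2 (by rw [Set.mem_ofPred_eq, cubic_eq hm]; exact ht0)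
  refine lt_of_lt_of_le (lt_of_le_of_ne ht.1 ?_) hta
  rintro rfl
  exact hx.ne ht0

/-- Negativity amounts to `√r * (r - C - 1) < √2 / 2 * (r - C)`. Squaring makes the test rational,
so it can be decided numerically for small `m`. -/
theorem cubic_sqrt_neg_of_sq_lt {r C : ℝ} (hr : 0 ≤ r) (hq : 0 ≤ r - C)
    (h : r * (r - C - 1) ^ 2 < (r - C) ^ 2 / 2) :
    (√r - √2 / 2) * (√r ^ 2 - C) - √r < 0 := by
  rw [Real.sq_sqrt hr]
  have h2 : √r * (r - C - 1) < √2 / 2 * (r - C) := by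
    refine lt_of_pow_lt_pow_left₀ 2 (by positivity) ?_
    rw [mul_pow, mul_pow, Real.sq_sqrt hr, div_pow, Real.sq_sqrt (by norm_num)]
    linarith
  linarith

theorem cubic_sqrt_abcThreshold_neg {m : ℕ} (hm : 4 ≤ m) :
    (√(abcThreshold m) - √2 / 2) *
      (√(abcThreshold m) ^ 2 - ((m : ℝ) ^ 2 - 5 * m + 6) / (m - 1)) - √(abcThreshold m) < 0 := by
  have hr := (abcThreshold_pos hm).le
  rcases Nat.lt_or_ge m 11 with h11 | h11
  · refine cubic_sqrt_neg_of_sq_lt hr ?_ ?_ <;> rw [abcThreshold] <;> interval_cases m <;> norm_num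
  · have hm' : (11 : ℝ) ≤ m := by exact_mod_cast h11
    have h1 : (m : ℝ) - 1 ≠ 0 := by linarith
    have h2 : 2 * (m : ℝ) - 7 ≠ 0 := by linarith
    have hq : abcThreshold m - ((m : ℝ) ^ 2 - 5 * m + 6) / (m - 1) =
        (2 * (m : ℝ) ^ 2 - 10 * m + 18) / ((2 * m - 7) * (m - 1)) := by
      have hx := div_mul_cancel₀ (3 : ℝ) h2
      have hy := div_mul_cancel₀ ((m : ℝ) ^ 2 - 5 * m + 6) h1
      rw [abcThreshold, if_neg (by omega), eq_div_iff (mul_ne_zero h2 h1)]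
      linear_combination ((m : ℝ) - 1) * hx - (2 * (m : ℝ) - 7) * hy
    have hd : 0 < (2 * (m : ℝ) - 7) * (m - 1) := mul_pos (by linarith) (by linarith)
    have hq0 : 0 < abcThreshold m - ((m : ℝ) ^ 2 - 5 * m + 6) / (m - 1) := by
      rw [hq]
      exact div_pos (by nlinarith) hd
    -- Clearing denominators, this is exactly `11 ≤ m`, which explains the case split. It makes `√R
    -- * (R - C) ≤ √R`, and the remaining term `-√2 / 2 * (R - C)` is negative.
    have hq1 : abcThreshold m - ((m : ℝ) ^ 2 - 5 * m + 6) / (m - 1) ≤ 1 := by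
      rw [hq, div_le_one hd]
      nlinarith
    rw [Real.sq_sqrt hr]
    have h3 : 0 < √2 / 2 * (abcThreshold m - ((m : ℝ) ^ 2 - 5 * m + 6) / (m - 1)) := by positivity
    have h4 := mul_le_mul_of_nonneg_left hq1 (Real.sqrt_nonneg (abcThreshold m))
    linarith

end Cubic

/-! ### The dichotomy and the conclusion -/

namespace Hypergraph

variable {V : Type*} [Fintype V] {G : Hypergraph V}

theorem degree_add_two_le {u : V} (h : ∃ e ∈ G.edgeSet, ∃ f ∈ G.edgeSet, u ∉ e ∧ u ∉ f ∧ e ≠ f) :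
    G.degree u + 2 ≤ G.edgeSet.ncard := by
  classical
  obtain ⟨e, he, f, hf, hue, huf, hef⟩ := h
  rw [degree_eq_card_edgesAt, ← card_edges, ← Finset.card_pair hef, ← Finset.card_union_of_disjoint]
  · refine Finset.card_le_card fun c hc => ?_
    simp only [Finset.mem_union, mem_edgesAt, Finset.mem_insert, Finset.mem_singleton] at hc
    rw [mem_edges]
    rcases hc with hc | rfl | rfl
    exacts [hc.1, he, hf]
  · rw [Finset.disjoint_left]
    intro c hc hc'
    simp only [mem_edgesAt, Finset.mem_insert, Finset.mem_singleton] at hc hc'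
    rcases hc' with rfl | rfl
    exacts [hue hc.2, huf hc.2]

theorem IsUnicyclic.exists_two_le_degree (huni : G.IsUnicyclic) : ∃ x, 2 ≤ G.degree x := by
  classical
  obtain ⟨-, ⟨S, F⟩, hC, -⟩ := huni
  obtain ⟨l, v, e, h, -⟩ := hC.exists_isClosedChain
  have hl := h.two_le
  refine ⟨v 1, ?_⟩
  have hne : (e 0).1 ≠ (e 1).1 := fun h1 =>
    zero_ne_one (h.inj_block 0 (by omega) 1 (by omega) (Subtype.ext h1))
  rw [degree_eq_card_edgesAt, ← Finset.card_pair hne]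
  refine Finset.card_le_card fun c hc => ?_
  simp only [Finset.mem_insert, Finset.mem_singleton] at hc
  rw [mem_edgesAt]
  rcases hc with rfl | rfl
  exacts [⟨(e 0).2, h.right 0 (by omega)⟩, ⟨(e 1).2, h.left 1 (by omega)⟩]

end Hypergraph

theorem mainTheorem5 {V : Type*} [Fintype V] (k m : ℕ) (hk : 3 ≤ k) (hm : 3 ≤ m)
    (G : Hypergraph V) (hV : G.vertexSet = Set.univ) (hunif : G.IsUniform k)
    (hlin : G.IsLinear) (huni : G.IsUnicyclic) (hsize : G.edgeSet.ncard = m) :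
    IsGreatest (tensorEigenvalueModuli (G.abcTensor k)) (G.abcSpectralRadius k) ∧
    ∃ a : ℝ,
      IsGreatest {t : ℝ | t ^ 3 - √2 / 2 * t ^ 2
          - ((m : ℝ) ^ 2 - 4 * m + 5) / ((m : ℝ) - 1) * t
          + √2 * ((m : ℝ) ^ 2 - 5 * m + 6) / (2 * ((m : ℝ) - 1)) = 0} a ∧
      G.abcSpectralRadius k ≤ a ^ ((2 : ℝ) / k) ∧
      (G.abcSpectralRadius k = a ^ ((2 : ℝ) / k) ↔
        G.IsIsomorphic (Hypergraph.unicyclicU3 k m hk)) := by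
  obtain ⟨x₀, hx₀⟩ := huni.exists_two_le_degree
  have : Nonempty V := ⟨x₀⟩
  have hk0 : k ≠ 0 := by omega
  have hgr : IsGreatest (tensorEigenvalueModuli (G.abcTensor k)) (G.abcSpectralRadius k) :=
    isGreatest_tensorSpectralRadius hk0 (Hypergraph.abcTensor_moduli_nonempty hk hunif)
  obtain ⟨a, ha⟩ := exists_isGreatest_cubicRoots hm
  -- The cubic is negative at `√2 / 2`; the strict inequality makes the labels containing `t - √2 /
  -- 2` positive.
  have has : √2 / 2 < a := lt_of_cubic_neg hm ha (by
    have : 0 < √2 / 2 := by positivity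
    linarith)
  have ha0 : 0 < a := lt_trans (by positivity) has
  have hpow : a ^ ((2 : ℝ) / k) = (a ^ 2) ^ ((1 : ℝ) / k) := by
    rw [← Real.rpow_natCast, ← Real.rpow_mul ha0.le]
    congr 1
    push_cast
    ring
  refine ⟨hgr, a, ha, ?_⟩
  rw [hpow]
  -- The existence of a vertex missing at most one edge is exactly what separates `U_{m,3}` from all
  -- other hypergraphs considered.
  by_cases hu : ∃ u, ∀ e ∈ G.edgeSet, ∀ f ∈ G.edgeSet, u ∉ e → u ∉ f → e = f
  · obtain ⟨u, hu⟩ := hu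
    obtain ⟨p, q, e₀, f, e₁, h⟩ := Hypergraph.exists_isTriangleSun hlin huni hu
    have heq := h.abcSpectralRadius_eq hk hm hunif hlin (huni.one_le_degree hV) hsize has ha.1
    exact ⟨heq.le, fun _ => h.isIsomorphic hk hm hV hunif hlin huni hsize, fun _ => heq⟩
  · have hdeg : ∀ x, G.degree x + 2 ≤ m := fun x => by
      rw [← hsize]
      refine Hypergraph.degree_add_two_le ?_
      by_contra hc
      refine hu ⟨x, fun e he f hf hxe hxf => ?_⟩
      by_contra hef
      exact hc ⟨e, he, f, hf, hxe, hxf, hef⟩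
    have hm4 : 4 ≤ m := (Nat.add_le_add_right hx₀ 2).trans (hdeg x₀)
    have hlt : G.abcSpectralRadius k < (a ^ 2) ^ ((1 : ℝ) / k) := by
      obtain ⟨z, hz, hzr⟩ := hgr.1
      rw [hzr]
      refine (Hypergraph.norm_eigenvalue_le_abcThreshold hk0 hm4 hunif hlin hdeg
        (hsize ▸ huni.sum_degree_sub_one_le hlin hV) hz).trans_lt ?_
      have hthr := lt_of_cubic_neg hm ha (cubic_sqrt_abcThreshold_neg hm4)
      exact Real.rpow_lt_rpow (abcThreshold_pos hm4).le
        ((Real.sqrt_lt' ha0).1 hthr) (by positivity)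
    exact ⟨hlt.le, fun h => absurd h hlt.ne,
      fun h => absurd (Hypergraph.exists_vertex_of_isIsomorphic hk h) hu⟩
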